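/- **Setting.** Let $n\ge 1$, let $p^Y$ be a probability distribution on $\{1,\dots,n\}$, let $\beta,\tau>0$, and for each $y\in\{1,\dots,n\}$ let $\mathcal N_y$ be a symmetric set of pairs of distinct states (the allowed transitions of $X$ when the measurement outcome is $y$). A feedback process consists of measurable transition rates $R_t^{X|y}(x,x')\ge 0$ (from $(x',y)$ to $(x,y)$), which vanish off $\mathcal N_y$ and satisfy $R_t^{X|y}(x,x')=0\iff R_t^{X|y}(x',x)=0$, and of joint distributions $p_t^{XY}$, $0\le t\le\tau$, with $p_0^{XY}(x,y)=\delta_{x,y}\,p^Y(y)$ that solve, in integrated form, the master equation $$\frac{d}{dt}p_t^{XY}(x,y)=\sum_{x'}J_t^{X|y}(x,x'),\qquad J_t^{X|y}(x,x')=j_t^{X|y}(x,x')-j_t^{X|y}(x',x),\qquad j_t^{X|y}(x,x')=R_t^{X|y}(x,x')\,p_t^{XY}(x',y).$$ Put $F_t^{X|y}(x,x')=\ln\frac{j_t^{X|y}(x,x')}{j_t^{X|y}(x',x)}$ and $\ln\frac{R_t^{X|y}(x,x')}{R_t^{X|y}(x',x)}=-\beta Q_t^{X|y}(x,x')$ (with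 $Q_t^{X|y}(x,x')=0$ where both rates vanish). All $j_t^{X|y}(x,x')$ and $Q_t^{X|y}(x,x')\,j_t^{X|y}(x,x')$ are assumed integrable over $[0,\tau]$. With the Shannon entropy $S(p)=-\sum p\ln p$ let $$Q_\tau^X=\int_0^\tau\sum_{x,x',y}Q_t^{X|y}(x,x')\,j_t^{X|y}(x,x')\,dt,\qquad \Sigma_\tau^X=S(p_\tau^X)-S(p_0^X)-\beta Q_\tau^X,$$ $$\Delta I=I_\tau-I_0,\quad I_t=S(p_t^X)+S(p_t^Y)-S(p_t^{XY}),\qquad \langle m\rangle_\tau=\frac1\tau\int_0^\tau\sum_y\sum_{x>x'}\frac{J_t^{X|y}(x,x')}{F_t^{X|y}(x,x')}\,dt,$$ where $J/F$ is extended continuously: it is the common value of the two fluxes if they are equal, and $0$ if exactly one of them vanishes. Let $p^Y_\downarrow(1)\ge\dots\ge p^Y_\downarrow(n)$ be the values of $p^Y$ in descending order. If $p^Y_\downarrow(1)\ge 1-\mathcal W$, put $\tilde p^Y_{\mathcal W}=p^Y_\downarrow$. Otherwise, for $0\le\mathcal W<1-p^Y_\downarrow(1)$, let $M_{\mathcal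 W}$ be the largest $m\in\{2,\dots,n\}$ with $\frac{\mathcal W-\sum_{i>m}p^Y_\downarrow(i)}{m-1}<p^Y_\downarrow(m)$, let $q_{\mathcal W}=\frac{\mathcal W-\sum_{i>M_{\mathcal W}}p^Y_\downarrow(i)}{M_{\mathcal W}-1}$, and put $\tilde p^Y_{\mathcal W}(1)=1-\mathcal W$, $\tilde p^Y_{\mathcal W}(i)=q_{\mathcal W}$ for $2\le i\le M_{\mathcal W}$, and $\tilde p^Y_{\mathcal W}(i)=p^Y_\downarrow(i)$ for $i>M_{\mathcal W}$. **Claims.** 1. The map $\mathcal W\mapsto S(\tilde p^Y_{\mathcal W})$ is strictly increasing on $[0,1-p^Y_\downarrow(1)]$, maps this interval bijectively onto $[0,S(p^Y)]$, and has the constant value $S(p^Y)$ for $\mathcal W\ge 1-p^Y_\downarrow(1)$. Let $\mathcal W^{\min}_{p^Y}:[0,S(p^Y)]\to[0,1-p^Y_\downarrow(1)]$ be its inverse. 2. For every feedback process, $|\Delta I|\in[0,S(p^Y)]$ and $$\Sigma_\tau^X\ \ge\ -|\Delta I|+\frac{\mathcal W^{\min}_{p^Y}(|\Delta I|)^2}{\tau\langle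 m\rangle_\tau},$$ where the last term is read as $0$ if $\langle m\rangle_\tau=0$. 3. Assume condition (C): for all $y$ and all $x\ne y$, the transition between $y$ and $x$ belongs to $\mathcal N_y$. Let $\sigma$ be any permutation such that $\sigma(y)$ is a rank of $y$ in a descending order of $p^Y$ (ties broken arbitrarily), let $0<I\le S(p^Y)$ and $\mathcal W=\mathcal W^{\min}_{p^Y}(I)$. Let $p_*(x,y)=p_*^X(x)\,p_*^{Y|x}(y)$ with $$p_*^X(x)=\begin{cases}\dfrac{p^Y(x)-q_{\mathcal W}}{1-\mathcal W-q_{\mathcal W}},&\sigma(x)\le M_{\mathcal W},\\[1ex]0,&\sigma(x)>M_{\mathcal W},\end{cases}\qquad p_*^{Y|x}(y)=\begin{cases}\tilde p^Y_{\mathcal W}(1),&y=x,\\ \tilde p^Y_{\mathcal W}(\sigma(x)),&y\ne x,\ \sigma(y)=1,\\ \tilde p^Y_{\mathcal W}(\sigma(y)),&\text{otherwise,}\end{cases}$$ except that in the endpoint case $\mathcal W=1-p^Y_\downarrow(1)$ the distribution $p_*^X$ is concentrated on the state of rank $1$. Call a feedback process optimal if $p_\tau^{XY}=p_*$ and the following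 two conditions hold. * It transports probability along an optimal transport plan. That is, there is a plan $\pi_{(x,y),(x',y)}\ge 0$ from $p_0^{XY}$ to $p_\tau^{XY}$ which has minimal cost, where the cost per unit probability is the least number of allowed transitions from $(x',y)$ to $(x,y)$, and $\int_0^\tau\max(J_t^{X|y}(x,x'),0)\,dt=\pi_{(x,y),(x',y)}$ for all $y$ and $x\ne x'$. * Its thermodynamic force is constant and uniform. That is, there is a constant $F$ such that $|F_t^{X|y}(x,x')|=F$ for almost every $t\in[0,\tau]$ whenever $j_t^{X|y}(x,x')\ne0$. Then every optimal process has $|\Delta I|=I$ and attains equality in claim 2, and for every $m>0$ there is an optimal process with $\langle m\rangle_\tau=m$. -/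

import Mathlib

open Set MeasureTheory
open scoped ENNReal

noncomputable section

namespace Feedback

/-- Shannon entropy `S(p) = -∑ p ln p` (with `0 ln 0 = 0`). -/
def entropy {ι : Type*} [Fintype ι] (p : ι → ℝ) : ℝ := ∑ i, Real.negMulLog (p i)

/-! ### The extremal distribution of the achievable Fano inequality

States are `Fin n`; the rank `r : Fin n` stands for the `(r+1)`-th largest value. -/

/-- `p↓`: the values of `p` in descending order; `pDown p 0` is the largest value. -/
def pDown {n : ℕ} (p : Fin n → ℝ) : Fin n → ℝ :=
  p ∘ Tuple.sort (fun i => OrderDual.toDual (p i))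

/-- `M_E`: the largest `m ∈ {2, …, n}` with
`(E - ∑_{i > m} p↓(i)) / (m - 1) < p↓(m)`; the `m`-th value of `p↓` is `pDown p k`, `k = m - 1`. -/
def fanoM {n : ℕ} (p : Fin n → ℝ) (E : ℝ) : ℕ :=
  sSup {m : ℕ | 2 ≤ m ∧ ∃ k : Fin n, (k : ℕ) + 1 = m ∧
    (E - ∑ i ∈ Finset.Ioi k, pDown p i) / ((m : ℝ) - 1) < pDown p k}

/-- The common value `(E - ∑_{i > M_E} p↓(i)) / (M_E - 1)` of the ranks `2, …, M_E`. -/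
def fanoLevel {n : ℕ} (p : Fin n → ℝ) (E : ℝ) : ℝ :=
  (E - ∑ i ∈ Finset.univ.filter (fun i : Fin n => fanoM p E ≤ (i : ℕ)), pDown p i) / ((fanoM p E : ℝ) - 1)

/-- The distribution `p̃_E`. -/
def fanoDist {n : ℕ} [NeZero n] (p : Fin n → ℝ) (E : ℝ) (r : Fin n) : ℝ :=
  if 1 - E ≤ pDown p 0 then pDown p r
  else if r = 0 then 1 - E
  else if (r : ℕ) + 1 ≤ fanoM p E then fanoLevel p E
  else pDown p r

/-- `W ↦ S(p̃_W)`. -/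
def fanoEntropy {n : ℕ} [NeZero n] (p : Fin n → ℝ) (W : ℝ) : ℝ := entropy (fanoDist p W)

/-- `W^min_p`: the inverse of `W ↦ S(p̃_W)` on `[0, 1 - p↓(1)]`. -/
def Wmin {n : ℕ} [NeZero n] (p : Fin n → ℝ) : ℝ → ℝ :=
  Function.invFunOn (fanoEntropy p) (Icc 0 (1 - pDown p 0))

/-! ### The optimal final distribution -/

/-- The `X`-marginal of the optimal final distribution. `σ y` is the rank of `y`. At the endpoint
`1 - W ≤ p↓(1)`, where `p̃_W = p↓`, all of the mass sits at the state of rank one. -/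
def optMarginal {n : ℕ} [NeZero n] (p : Fin n → ℝ) (σ : Equiv.Perm (Fin n)) (W : ℝ)
    (x : Fin n) : ℝ :=
  if 1 - W ≤ pDown p 0 then (if σ x = 0 then 1 else 0)
  else if (σ x : ℕ) + 1 ≤ fanoM p W then
    (p x - fanoLevel p W) / (fanoDist p W 0 - fanoLevel p W)
  else 0

/-- The conditional distribution of `Y` given `X = x`: `p̃_W` arranged by rank, with the values at
`y = x` and at the state of rank one swapped. -/
def optConditional {n : ℕ} [NeZero n] (p : Fin n → ℝ) (σ : Equiv.Perm (Fin n)) (W : ℝ)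
    (x y : Fin n) : ℝ :=
  if y = x then fanoDist p W 0
  else if σ y = 0 then fanoDist p W (σ x)
  else fanoDist p W (σ y)

/-- The optimal final joint distribution `(x, y) ↦ p^X(x) p^{Y|x}(y)`. -/
def optFinal {n : ℕ} [NeZero n] (p : Fin n → ℝ) (σ : Equiv.Perm (Fin n)) (W : ℝ)
    (x y : Fin n) : ℝ :=
  optMarginal p σ W x * optConditional p σ W x y

/-! ### Feedback processes

`R t y x x'` is the rate of `(x', y) → (x, y)` at time `t`, and `p t x y` the probability of
`(x, y)`. The graph `G y` on the states of `X` holds the allowed transitions for the outcome `y`. -/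

section Rates

variable {n : ℕ} (R : ℝ → Fin n → Fin n → Fin n → ℝ) (p : ℝ → Fin n → Fin n → ℝ)

/-- `j(x, x') = R(x, x') p(x', y)`: expected number of jumps `(x', y) → (x, y)` per unit time. -/
def flux (t : ℝ) (y x x' : Fin n) : ℝ := R t y x x' * p t x' y

/-- The net current `J(x, x') = j(x, x') - j(x', x)` from `(x', y)` to `(x, y)`. -/
def current (t : ℝ) (y x x' : Fin n) : ℝ := flux R p t y x x' - flux R p t y x' x

/-- The thermodynamic force `F(x, x') = ln (j(x, x') / j(x', x))`. -/
def force (t : ℝ) (y x x' : Fin n) : ℝ := Real.log (flux R p t y x x' / flux R p t y x' x)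

/-- The local mobility `J / F`, extended continuously to `J = F = 0` (by the common value of
`j(x, x')` and `j(x', x)`); it is `0` if one of the two fluxes is `0`. -/
def localMobility (t : ℝ) (y x x' : Fin n) : ℝ :=
  if current R p t y x x' = 0 then flux R p t y x x'
  else current R p t y x x' / force R p t y x x'

/-- The heat absorbed in a jump `(x', y) → (x, y)`, given by local detailed balance
`ln (R(x, x') / R(x', x)) = -β Q(x, x')`. -/
def heat (β : ℝ) (t : ℝ) (y x x' : Fin n) : ℝ :=
  -(1 / β) * Real.log (R t y x x' / R t y x' x)

end Rates

/-- A feedback process on `[0, τ]` after an error-free measurement with outcome distribution `pY`: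
time-dependent rates and the solution (in the integrated sense, so that rates may be switched and
may diverge at isolated times) of the master equation started at `δ_{x,y} pY(y)`. -/
structure FeedbackProcess {n : ℕ} (G : Fin n → SimpleGraph (Fin n)) (pY : Fin n → ℝ) (β τ : ℝ) where
  /-- the transition rates -/
  rate : ℝ → Fin n → Fin n → Fin n → ℝ
  /-- the joint distribution -/
  prob : ℝ → Fin n → Fin n → ℝ
  rate_measurable : ∀ y x x', Measurable fun t => rate t y x x'
  rate_nonneg : ∀ t y x x', 0 ≤ rate t y x x'
  /-- only transitions along the edges of `G y` occur -/
  rate_eq_zero : ∀ t y x x', ¬ (G y).Adj x' x → rate t y x x' = 0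
  /-- transitions are bidirectional -/
  rate_bidirectional : ∀ t y x x', rate t y x x' = 0 → rate t y x' x = 0
  prob_nonneg : ∀ t ∈ Icc 0 τ, ∀ x y, 0 ≤ prob t x y
  prob_zero : ∀ x y, prob 0 x y = if x = y then pY y else 0
  /-- the expected number of jumps along each transition is finite -/
  flux_integrable : ∀ y x x', IntervalIntegrable (fun t => flux rate prob t y x x') volume 0 τ
  /-- the master equation -/
  master : ∀ t ∈ Icc 0 τ, ∀ x y, prob t x y = prob 0 x y +
    ∫ s in (0 : ℝ)..t, ∑ x', (flux rate prob s y x x' - flux rate prob s y x' x)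
  /-- the expected heat exchanged along each transition is finite -/
  heat_integrable : ∀ y x x',
    IntervalIntegrable (fun t => heat rate β t y x x' * flux rate prob t y x x') volume 0 τ

namespace FeedbackProcess

variable {n : ℕ} {G : Fin n → SimpleGraph (Fin n)} {pY : Fin n → ℝ} {β τ : ℝ}
  (P : FeedbackProcess G pY β τ)

/-- The marginal distribution of `X`. -/
def probX (t : ℝ) (x : Fin n) : ℝ := ∑ y, P.prob t x y

/-- The marginal distribution of `Y`. -/
def probY (t : ℝ) (y : Fin n) : ℝ := ∑ x, P.prob t x y

/-- The mutual information `S(p^X) + S(p^Y) - S(p^{XY})`. -/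
def mutualInfo (t : ℝ) : ℝ :=
  entropy (P.probX t) + entropy (P.probY t)
    - entropy (fun z : Fin n × Fin n => P.prob t z.1 z.2)

/-- The change `ΔI` of the mutual information. -/
def deltaI : ℝ := P.mutualInfo τ - P.mutualInfo 0

/-- The total heat absorbed by `X`. -/
def totalHeat : ℝ :=
  ∫ t in (0 : ℝ)..τ, ∑ y, ∑ x, ∑ x', heat P.rate β t y x x' * flux P.rate P.prob t y x x'

/-- The entropy production of the subsystem `X`. -/
def entropyProductionX : ℝ := entropy (P.probX τ) - entropy (P.probX 0) - β * P.totalHeat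

/-- The time-averaged mobility. -/
def meanMobility : ℝ :=
  (1 / τ) * ∫ t in (0 : ℝ)..τ,
    ∑ y, ∑ x, ∑ x' ∈ Finset.Iio x, localMobility P.rate P.prob t y x x'

/-- Constant uniform thermodynamic force of magnitude `F`: at almost every time, the force on every
transition that is in use has magnitude `F`. -/
def HasConstantUniformForce (F : ℝ) : Prop :=
  ∀ᵐ t ∂(volume.restrict (Icc 0 τ)), ∀ y x x', flux P.rate P.prob t y x x' ≠ 0 →
    |force P.rate P.prob t y x x'| = F

/-- Probability is transported along the plan `π`: for `x' ≠ x`, the probability carried by the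
current through the direct transition `(x', y) → (x, y)` is the amount that `π` assigns to it. -/
def TransportsAlong (π : Fin n → Fin n → Fin n → ℝ) : Prop :=
  ∀ y x x', x ≠ x' →
    ∫ t in (0 : ℝ)..τ, max (current P.rate P.prob t y x x') 0 = π y x x'

end FeedbackProcess

/-! ### Optimal transport -/

/-- `π y x x'` is the probability transported from `(x', y)` to `(x, y)`. -/
structure IsTransportPlan {n : ℕ} (p q : Fin n → Fin n → ℝ) (π : Fin n → Fin n → Fin n → ℝ) :
    Prop where
  nonneg : ∀ y x x', 0 ≤ π y x x'
  source : ∀ y x', ∑ x, π y x x' = p x' y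
  target : ∀ y x, ∑ x', π y x x' = q x y

/-- The cost of a plan; the cost per unit probability is the least number of transitions from
`(x', y)` to `(x, y)` (infinite if there is no path). -/
def transportCost {n : ℕ} (G : Fin n → SimpleGraph (Fin n)) (π : Fin n → Fin n → Fin n → ℝ) :
    ℝ≥0∞ :=
  ∑ y, ∑ x, ∑ x', (((G y).edist x' x : ℕ∞) : ℝ≥0∞) * ENNReal.ofReal (π y x x')

/-- `π` has the least cost, the Wasserstein distance of `p` and `q`, among the plans from `p` to
`q`. -/
def IsOptimalPlan {n : ℕ} (G : Fin n → SimpleGraph (Fin n)) (p q : Fin n → Fin n → ℝ)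
    (π : Fin n → Fin n → Fin n → ℝ) : Prop :=
  IsTransportPlan p q π ∧ ∀ π', IsTransportPlan p q π' → transportCost G π ≤ transportCost G π'

/-- Condition (C): for every outcome `y`, the direct transition from `(y, y)` to any other `(x, y)`
is possible. -/
def ConditionC {n : ℕ} (G : Fin n → SimpleGraph (Fin n)) : Prop :=
  ∀ y x, x ≠ y → (G y).Adj y x

/-- The process ends in `q` and gets there along an optimal transport plan with constant uniform
thermodynamic force. -/
def FeedbackProcess.IsOptimalProtocolTo {n : ℕ} {G : Fin n → SimpleGraph (Fin n)} {pY : Fin n → ℝ}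
    {β τ : ℝ} (P : FeedbackProcess G pY β τ) (q : Fin n → Fin n → ℝ) : Prop :=
  P.prob τ = q ∧
  (∃ π, IsOptimalPlan G (P.prob 0) (P.prob τ) π ∧ P.TransportsAlong π) ∧
  ∃ F, P.HasConstantUniformForce F

end Feedback

end

/-!
The measured value of `Y` is fixed during the feedback, so `|ΔI|` is the conditional entropy
`S(Y | X)` at the end of the process, and a process that ends with error probability
`W = P(X ≠ Y)` has to move at least the probability `W`.

The extremal distribution at error probability `W` is `p` cut off at a level `q`, with the missing
mass put on one state. Gibbs' inequality against this distribution bounds the conditional entropy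
of every joint distribution with marginal `p` by a function that is affine in the error
probability; joint distributions that mix rearrangements of the extremal distribution attain the
bound. Hence an error of at least `Wmin |ΔI|` is needed.

The entropy production of `X` exceeds `-|ΔI|` by `∑ ∫ J F`. The Cauchy-Schwarz inequality for
`|J| = √(J / F) √(J F)` bounds the transported probability, and a constant force together with
direct transport turns both inequalities into equalities.
-/

namespace Feedback

section Truncation

variable {ι κ : Type*} [Fintype ι] [Fintype κ] {p : ι → ℝ} {q W : ℝ} {x y : ι}

/-- The mass that is left outside one state of full height when the distribution `p` is cut off at
the level `q`: the error probability of the extremal distribution. -/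
def truncErr (p : ι → ℝ) (q : ℝ) : ℝ := ∑ y, min (p y) q - q

/-- The extremal distribution: `p` cut off at the level `q`, with all of the missing mass put on
the state `x`. It is normalised if `q ≤ p x`. -/
noncomputable def truncDist [DecidableEq ι] (p : ι → ℝ) (q : ℝ) (x : ι) : ι → ℝ :=
  Function.update (fun y => min (p y) q) x (1 - truncErr p q)

/-- The entropy of the extremal distribution, which does not depend on the state `x` that carries
the missing mass as long as `q ≤ p x`. -/
noncomputable def truncEntropy (p : ι → ℝ) (q : ℝ) : ℝ :=
  Real.negMulLog (1 - truncErr p q) + ∑ y, Real.negMulLog (min (p y) q) - Real.negMulLog q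

theorem sum_min_eq (p : ι → ℝ) (q : ℝ) : ∑ y, min (p y) q = truncErr p q + q :=
  (sub_add_cancel _ _).symm

theorem truncErr_comp_equiv (p : ι → ℝ) (q : ℝ) (e : κ ≃ ι) :
    truncErr (p ∘ e) q = truncErr p q :=
  congrArg (· - q) (e.sum_comp fun y => min (p y) q)

theorem truncEntropy_comp_equiv (p : ι → ℝ) (q : ℝ) (e : κ ≃ ι) :
    truncEntropy (p ∘ e) q = truncEntropy p q := by
  rw [truncEntropy, truncEntropy, truncErr_comp_equiv,
    ← e.sum_comp fun y => Real.negMulLog (min (p y) q)]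
  rfl

theorem continuous_truncErr (p : ι → ℝ) : Continuous (truncErr p) := by
  unfold truncErr
  fun_prop

theorem continuous_truncEntropy (p : ι → ℝ) : Continuous (truncEntropy p) := by
  have := continuous_truncErr p
  unfold truncEntropy
  fun_prop

theorem truncErr_zero (hp : ∀ y, 0 ≤ p y) : truncErr p 0 = 0 := by
  simp [truncErr, min_eq_right (hp _)]

theorem truncEntropy_zero (hp : ∀ y, 0 ≤ p y) : truncEntropy p 0 = 0 := by
  simp [truncEntropy, truncErr_zero hp, min_eq_right (hp _)]

theorem truncErr_of_forall_le (hp : ∑ y, p y = 1) (hq : ∀ y, p y ≤ q) : truncErr p q = 1 - q := by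
  simp [truncErr, min_eq_left (hq _), hp]

theorem truncEntropy_of_forall_le (hp : ∑ y, p y = 1) (hq : ∀ y, p y ≤ q) :
    truncEntropy p q = entropy p := by
  simp [truncEntropy, truncErr_of_forall_le hp hq, min_eq_left (hq _), entropy]

theorem truncErr_nonneg (hp : ∀ y, 0 ≤ p y) (hq₀ : 0 ≤ q) (hq : q ≤ p x) : 0 ≤ truncErr p q := by
  rw [truncErr, sub_nonneg]
  nth_rewrite 1 [← min_eq_right hq]
  exact Finset.single_le_sum (f := fun y => min (p y) q) (fun y _ => le_min (hp y) hq₀)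
    (Finset.mem_univ x)

theorem exists_truncErr_eq (hp : p ∈ stdSimplex ℝ ι) (hx : ∀ y, p y ≤ p x)
    (hW : W ∈ Icc 0 (1 - p x)) : ∃ q ∈ Icc 0 (p x), truncErr p q = W := by
  refine intermediate_value_Icc (hp.1 x) (continuous_truncErr p).continuousOn ?_
  rwa [truncErr_zero hp.1, truncErr_of_forall_le hp.2 hx]

theorem one_sub_sub_truncErr [DecidableEq ι] (hp : ∑ y, p y = 1) (hq : q ≤ p x) :
    1 - p x - truncErr p q = ∑ y ∈ Finset.univ.erase x, (p y - min (p y) q) := by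
  have h := Finset.add_sum_erase Finset.univ (fun y => p y - min (p y) q) (Finset.mem_univ x)
  simp only [Finset.sum_sub_distrib (s := Finset.univ), hp, sum_min_eq, min_eq_right hq] at h
  linarith

theorem truncErr_le_one_sub (hp : ∑ y, p y = 1) (hq : q ≤ p x) : truncErr p q ≤ 1 - p x := by
  classical
  rw [← sub_nonneg, one_sub_sub_truncErr hp hq]
  exact Finset.sum_nonneg fun y _ => sub_nonneg.2 (min_le_left _ _)

theorem truncErr_lt_one_sub_iff (hp : ∑ y, p y = 1) (hq : q ≤ p x) :
    truncErr p q < 1 - p x ↔ ∃ y ≠ x, q < p y := by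
  classical
  rw [← sub_pos, one_sub_sub_truncErr hp hq,
    Finset.sum_pos_iff_of_nonneg fun y _ => sub_nonneg.2 (min_le_left _ _)]
  simp

theorem truncErr_eq_one_sub (hp : ∑ y, p y = 1) (hq : q ≤ p x) (h : 1 - p x ≤ truncErr p q) :
    truncErr p q = 1 - p x ∧ ∀ y ≠ x, p y ≤ q := by
  refine ⟨(truncErr_le_one_sub hp hq).antisymm h, ?_⟩
  have := (truncErr_lt_one_sub_iff hp hq).not.1 h.not_gt
  push Not at this
  exact this

theorem sum_mul_neg_log_min (hp : ∑ y, p y = 1) (q : ℝ) :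
    ∑ y, p y * -Real.log (min (p y) q) =
      ∑ y, Real.negMulLog (min (p y) q) - (1 - truncErr p q - q) * Real.log q := by
  have hsplit : ∀ y, p y * -Real.log (min (p y) q) =
      Real.negMulLog (min (p y) q) - (p y - min (p y) q) * Real.log q := by
    intro y
    rcases le_total (p y) q with h | h
    · rw [min_eq_left h, Real.negMulLog]
      ring
    · rw [min_eq_right h, Real.negMulLog]
      ring
  simp only [hsplit, Finset.sum_sub_distrib, ← Finset.sum_mul, hp, sum_min_eq]
  ring

variable [DecidableEq ι]

theorem truncDist_self (p : ι → ℝ) (q : ℝ) (x : ι) : truncDist p q x x = 1 - truncErr p q :=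
  Function.update_self ..

theorem truncDist_of_ne (p : ι → ℝ) (q : ℝ) (h : y ≠ x) : truncDist p q x y = min (p y) q :=
  Function.update_of_ne h ..

theorem truncDist_nonneg (hp : p ∈ stdSimplex ℝ ι) (hq₀ : 0 ≤ q) (hq : q ≤ p x) (y : ι) :
    0 ≤ truncDist p q x y := by
  rcases eq_or_ne y x with rfl | hyx
  · rw [truncDist_self]
    linarith [truncErr_le_one_sub hp.2 hq]
  · rw [truncDist_of_ne p q hyx]
    exact le_min (hp.1 y) hq₀

theorem sum_comp_truncDist (f : ℝ → ℝ) (hq : q ≤ p x) :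
    ∑ y, f (truncDist p q x y) = f (1 - truncErr p q) + ∑ y, f (min (p y) q) - f q := by
  rw [← Finset.add_sum_erase _ _ (Finset.mem_univ x), truncDist_self,
    ← Finset.add_sum_erase _ (fun y => f (min (p y) q)) (Finset.mem_univ x), min_eq_right hq,
    Finset.sum_congr rfl fun y hy => by rw [truncDist_of_ne p q (Finset.ne_of_mem_erase hy)]]
  ring

theorem sum_truncDist (hq : q ≤ p x) : ∑ y, truncDist p q x y = 1 := by
  have := sum_comp_truncDist id hq
  simp only [id, sum_min_eq] at this
  linarith

theorem entropy_truncDist (hq : q ≤ p x) : entropy (truncDist p q x) = truncEntropy p q :=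
  sum_comp_truncDist Real.negMulLog hq

end Truncation

section CondEntropy

variable {α β : Type*} [Fintype α] {u b : α → β → ℝ} {a : α → ℝ} {p : β → ℝ}

theorem eq_zero_of_marginal_eq_zero (hu : ∀ x y, 0 ≤ u x y) (hY : ∀ y, ∑ x, u x y = p y)
    {y : β} (h : p y = 0) (x : α) : u x y = 0 :=
  (Finset.sum_eq_zero_iff_of_nonneg fun x _ => hu x y).1 ((hY y).trans h) x (Finset.mem_univ x)

theorem one_sub_sum_diag_nonneg {p : α → ℝ} {u : α → α → ℝ} (hp : ∑ y, p y = 1)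
    (hu : ∀ x y, 0 ≤ u x y) (hY : ∀ y, ∑ x, u x y = p y) : 0 ≤ 1 - ∑ x, u x x := by
  rw [sub_nonneg, ← hp]
  refine Finset.sum_le_sum fun y _ => ?_
  rw [← hY y]
  exact Finset.single_le_sum (fun x _ => hu x y) (Finset.mem_univ y)

variable [Fintype β]

/-- The conditional entropy `S(Y | X)` of the joint distribution `u` of `(X, Y)`. -/
noncomputable def condEntropy (u : α → β → ℝ) : ℝ :=
  entropy (fun z : α × β => u z.1 z.2) - entropy (fun x => ∑ y, u x y)

theorem condEntropy_eq_sum (u : α → β → ℝ) :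
    condEntropy u = ∑ x, (∑ y, Real.negMulLog (u x y) - Real.negMulLog (∑ y, u x y)) := by
  rw [condEntropy, entropy, entropy, Fintype.sum_prod_type, Finset.sum_sub_distrib]

theorem negMulLog_sum_le {f : β → ℝ} (hf : ∀ y, 0 ≤ f y) :
    Real.negMulLog (∑ y, f y) ≤ ∑ y, Real.negMulLog (f y) := by
  rw [Real.negMulLog, neg_mul, ← mul_neg, Finset.sum_mul]
  refine Finset.sum_le_sum fun y _ => ?_
  rw [Real.negMulLog, neg_mul, ← mul_neg]
  rcases (hf y).eq_or_lt with h | h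
  · simp [← h]
  · gcongr
    exact Finset.single_le_sum (fun y _ => hf y) (Finset.mem_univ y)

theorem condEntropy_nonneg (hu : ∀ x y, 0 ≤ u x y) : 0 ≤ condEntropy u := by
  rw [condEntropy_eq_sum]
  exact Finset.sum_nonneg fun x _ => sub_nonneg.2 (negMulLog_sum_le (hu x))

theorem condEntropy_mul (h : ∀ x, a x ≠ 0 → ∑ y, b x y = 1) :
    condEntropy (fun x y => a x * b x y) = ∑ x, a x * entropy (b x) := by
  rw [condEntropy_eq_sum]
  refine Finset.sum_congr rfl fun x _ => ?_
  rcases eq_or_ne (a x) 0 with hx | hx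
  · simp [hx]
  · simp only [Real.negMulLog_mul, Finset.sum_add_distrib, ← Finset.sum_mul, ← Finset.mul_sum,
      h x hx, Real.negMulLog_one, entropy]
    ring

theorem condEntropy_eq_zero_of_diag {u : α → α → ℝ} (hu : ∀ x y, x ≠ y → u x y = 0) :
    condEntropy u = 0 := by
  rw [condEntropy_eq_sum]
  refine Finset.sum_eq_zero fun x _ => ?_
  rw [Finset.sum_eq_single x (fun y _ h => by rw [hu x y h.symm, Real.negMulLog_zero]) (by simp),
    Finset.sum_eq_single x (fun y _ h => hu x y h.symm) (by simp), sub_self]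

theorem negMulLog_le_neg_mul_log_add {a b : ℝ} (ha : 0 ≤ a) (hb : 0 < b) :
    Real.negMulLog a ≤ -(a * Real.log b) + (b - a) := by
  have h := mul_le_mul_of_nonneg_left
    (Real.negMulLog_le_one_sub_self (div_nonneg ha hb.le)) hb.le
  have hmul := Real.negMulLog_mul b (a / b)
  have hcancel : a / b * Real.negMulLog b = -(a * Real.log b) := by
    rw [Real.negMulLog]
    field_simp
  rw [mul_div_cancel₀ _ hb.ne', hcancel] at hmul
  rw [mul_sub, mul_one, mul_div_cancel₀ _ hb.ne'] at h
  linarith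

/-- Gibbs' inequality. -/
theorem condEntropy_le_sum_mul_neg_log (hu : ∀ x y, 0 ≤ u x y) (hb : ∀ x y, 0 ≤ b x y)
    (hb_sum : ∀ x, ∑ y, b x y ≤ 1) (hub : ∀ x y, b x y = 0 → u x y = 0) :
    condEntropy u ≤ ∑ x, ∑ y, u x y * -Real.log (b x y) := by
  rw [condEntropy_eq_sum]
  refine Finset.sum_le_sum fun x _ => ?_
  set s := ∑ y, u x y with hs
  have hs₀ : 0 ≤ s := Finset.sum_nonneg fun y _ => hu x y
  have hle : ∀ y ∈ Finset.univ, Real.negMulLog (u x y) ≤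
      u x y * -Real.log (b x y) - u x y * Real.log s + (s * b x y - u x y) := by
    intro y _
    rcases (hu x y).eq_or_lt with h | h
    · simp [← h, mul_nonneg hs₀ (hb x y)]
    · have hb' : 0 < b x y := (hb x y).lt_of_ne fun hb₀ => h.ne' (hub x y hb₀.symm)
      have hs' : 0 < s :=
        h.trans_le (Finset.single_le_sum (fun y _ => hu x y) (Finset.mem_univ y))
      have := negMulLog_le_neg_mul_log_add h.le (mul_pos hs' hb')
      rw [Real.log_mul hs'.ne' hb'.ne'] at this
      linarith
  have h := Finset.sum_le_sum hle
  simp only [Finset.sum_add_distrib, Finset.sum_sub_distrib, ← Finset.sum_mul,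
    ← Finset.mul_sum, ← hs] at h
  have := mul_le_mul_of_nonneg_left (hb_sum x) hs₀
  rw [Real.negMulLog]
  linarith

theorem condEntropy_le_entropy (hp : p ∈ stdSimplex ℝ β) (hu : ∀ x y, 0 ≤ u x y)
    (hY : ∀ y, ∑ x, u x y = p y) : condEntropy u ≤ entropy p := by
  refine (condEntropy_le_sum_mul_neg_log hu (b := fun _ y => p y) (fun _ => hp.1)
    (fun _ => hp.2.le) fun x y h => eq_zero_of_marginal_eq_zero hu hY h x).trans_eq ?_
  rw [Finset.sum_comm]
  refine Finset.sum_congr rfl fun y _ => ?_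
  rw [← Finset.sum_mul, hY, Real.negMulLog, neg_mul, mul_neg]

end CondEntropy

section Fano

variable {ι : Type*} [Fintype ι] [DecidableEq ι] {p : ι → ℝ} {q : ℝ} {u : ι → ι → ℝ}

/-- The test distributions of Gibbs' inequality in the proof of Fano's inequality: `p` cut off at
the level `q`, with the value at `x` rescaled so that it becomes `1 - truncErr p q` if `q ≤ p x`.
For `p x < q` the total mass is less than `1`. -/
noncomputable def fanoKernel (p : ι → ℝ) (q : ℝ) (x y : ι) : ℝ :=
  min (p y) q * if x = y then (1 - truncErr p q) / q else 1

theorem fanoKernel_nonneg (hp : ∀ y, 0 ≤ p y) (hq₀ : 0 < q) (hE : 0 < 1 - truncErr p q)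
    (x y : ι) : 0 ≤ fanoKernel p q x y :=
  mul_nonneg (le_min (hp y) hq₀.le) (by split_ifs <;> positivity)

theorem eq_zero_of_fanoKernel_eq_zero (hq₀ : 0 < q) (hE : 0 < 1 - truncErr p q) {x y : ι}
    (h : fanoKernel p q x y = 0) : p y = 0 := by
  have hmin : min (p y) q = 0 := by
    refine (mul_eq_zero.1 h).resolve_right ?_
    split_ifs
    exacts [(div_pos hE hq₀).ne', one_ne_zero]
  rcases min_choice (p y) q with h' | h' <;> rw [h'] at hmin
  exacts [hmin, absurd hmin hq₀.ne']

theorem sum_fanoKernel_le_one (hq₀ : 0 < q) (hqE : q ≤ 1 - truncErr p q) (x : ι) :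
    ∑ y, fanoKernel p q x y ≤ 1 := by
  have hsplit : ∀ y, fanoKernel p q x y =
      min (p y) q + if x = y then min (p y) q * ((1 - truncErr p q) / q - 1) else 0 := by
    intro y
    rw [fanoKernel]
    split_ifs <;> ring
  simp only [hsplit, Finset.sum_add_distrib, Finset.sum_ite_eq, Finset.mem_univ, if_true,
    sum_min_eq]
  have hratio : 0 ≤ (1 - truncErr p q) / q - 1 := sub_nonneg.2 ((one_le_div hq₀).2 hqE)
  have := mul_le_mul_of_nonneg_right (min_le_right (p x) q) hratio
  rw [mul_sub q, mul_div_cancel₀ _ hq₀.ne'] at this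
  linarith

theorem sum_mul_neg_log_fanoKernel (hp : ∑ y, p y = 1) (hu : ∀ x y, 0 ≤ u x y)
    (hY : ∀ y, ∑ x, u x y = p y) (hq₀ : 0 < q) (hE : 0 < 1 - truncErr p q) :
    ∑ x, ∑ y, u x y * -Real.log (fanoKernel p q x y) = truncEntropy p q +
      (1 - truncErr p q - ∑ x, u x x) * Real.log ((1 - truncErr p q) / q) := by
  have hsplit : ∀ x y, u x y * -Real.log (fanoKernel p q x y) =
      u x y * -Real.log (min (p y) q) -
        (if x = y then u x y else 0) * Real.log ((1 - truncErr p q) / q) := by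
    intro x y
    rcases eq_or_ne (fanoKernel p q x y) 0 with h | h
    · simp [eq_zero_of_marginal_eq_zero hu hY (eq_zero_of_fanoKernel_eq_zero hq₀ hE h)]
    · rw [fanoKernel, Real.log_mul (left_ne_zero_of_mul h) (right_ne_zero_of_mul h)]
      split_ifs
      · ring
      · simp
  simp only [hsplit, Finset.sum_sub_distrib, ← Finset.sum_mul, Finset.sum_ite_eq, Finset.mem_univ,
    if_true]
  rw [Finset.sum_comm]
  simp only [← Finset.sum_mul, hY, sum_mul_neg_log_min hp]
  rw [truncEntropy, Real.log_div hE.ne' hq₀.ne', Real.negMulLog, Real.negMulLog]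
  ring

end Fano

/-- Fano's inequality for a given marginal. -/
theorem condEntropy_le_truncEntropy_add {ι : Type*} [Fintype ι] {p : ι → ℝ} {q : ℝ}
    {u : ι → ι → ℝ} (hp : p ∈ stdSimplex ℝ ι) (hu : ∀ x y, 0 ≤ u x y)
    (hY : ∀ y, ∑ x, u x y = p y) (hq₀ : 0 < q) {z : ι} (hq : q ≤ p z) :
    condEntropy u ≤ truncEntropy p q +
      (1 - truncErr p q - ∑ x, u x x) * Real.log ((1 - truncErr p q) / q) := by
  classical
  have hqE : q ≤ 1 - truncErr p q := by linarith [truncErr_le_one_sub hp.2 hq]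
  have hE := hq₀.trans_le hqE
  exact (condEntropy_le_sum_mul_neg_log hu (fanoKernel_nonneg hp.1 hq₀ hE)
    (sum_fanoKernel_le_one hq₀ hqE) fun x y h => eq_zero_of_marginal_eq_zero hu hY
      (eq_zero_of_fanoKernel_eq_zero hq₀ hE h) x).trans_eq
    (sum_mul_neg_log_fanoKernel hp.2 hu hY hq₀ hE)

section Mixing

variable {ι : Type*} [Fintype ι] {p a : ι → ℝ} {q : ℝ}

/-- `a x` is the weight of the extremal distribution `truncDist p q x` in a mixture that has the
marginal `p`. -/
structure IsMixingWeight (p : ι → ℝ) (q : ℝ) (a : ι → ℝ) : Prop where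
  nonneg : ∀ x, 0 ≤ a x
  sum_eq_one : ∑ x, a x = 1
  le_of_ne_zero : ∀ x, a x ≠ 0 → q ≤ p x
  mul_eq : ∀ x, a x * (1 - truncErr p q - q) = p x - min (p x) q

namespace IsMixingWeight

variable [DecidableEq ι]

theorem sum_mul_truncDist (h : IsMixingWeight p q a) (y : ι) :
    ∑ x, a x * truncDist p q x y = p y := by
  have hsplit : ∀ x, a x * truncDist p q x y =
      a x * min (p y) q + if y = x then a x * (1 - truncErr p q - min (p y) q) else 0 := by
    intro x
    split_ifs with hyx
    · rw [hyx, truncDist_self]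
      ring
    · rw [truncDist_of_ne p q hyx, add_zero]
  simp only [hsplit, Finset.sum_add_distrib, ← Finset.sum_mul, h.sum_eq_one, Finset.sum_ite_eq,
    Finset.mem_univ, if_true]
  have hmul := h.mul_eq y
  rcases eq_or_ne (a y) 0 with h₀ | h₀
  · rw [h₀] at hmul ⊢
    linarith
  · rw [min_eq_right (h.le_of_ne_zero y h₀)] at hmul ⊢
    linarith

theorem sum_mul_truncDist_self (h : IsMixingWeight p q a) :
    ∑ x, a x * truncDist p q x x = 1 - truncErr p q := by
  simp only [truncDist_self, ← Finset.sum_mul, h.sum_eq_one, one_mul]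

theorem condEntropy_mul_truncDist (h : IsMixingWeight p q a) :
    condEntropy (fun x y => a x * truncDist p q x y) = truncEntropy p q := by
  rw [condEntropy_mul fun x hx => sum_truncDist (h.le_of_ne_zero x hx)]
  calc ∑ x, a x * entropy (truncDist p q x)
    _ = ∑ x, a x * truncEntropy p q := Finset.sum_congr rfl fun x _ => by
      rcases eq_or_ne (a x) 0 with hx | hx
      · rw [hx, zero_mul, zero_mul]
      · rw [entropy_truncDist (h.le_of_ne_zero x hx)]
    _ = truncEntropy p q := by rw [← Finset.sum_mul, h.sum_eq_one, one_mul]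

theorem mul_truncDist_nonneg (hp : p ∈ stdSimplex ℝ ι) (hq₀ : 0 ≤ q) (h : IsMixingWeight p q a)
    (x y : ι) : 0 ≤ a x * truncDist p q x y := by
  rcases eq_or_ne (a x) 0 with hx | hx
  · rw [hx, zero_mul]
  · exact mul_nonneg (h.nonneg x) (truncDist_nonneg hp hq₀ (h.le_of_ne_zero x hx) y)

end IsMixingWeight

theorem isMixingWeight_div (hp : ∑ y, p y = 1) (hq : 0 < 1 - truncErr p q - q) :
    IsMixingWeight p q fun x => (p x - min (p x) q) / (1 - truncErr p q - q) where
  nonneg x := div_nonneg (sub_nonneg.2 (min_le_left _ _)) hq.le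
  sum_eq_one := by
    rw [← Finset.sum_div, Finset.sum_sub_distrib, hp, sum_min_eq, ← sub_sub, div_self hq.ne']
  le_of_ne_zero x hx := by
    by_contra! h
    exact hx (by rw [min_eq_left h.le, sub_self, zero_div])
  mul_eq x := div_mul_cancel₀ _ hq.ne'

theorem isMixingWeight_single [DecidableEq ι] {x : ι} (hE : truncErr p q = 1 - p x)
    (hq : q ≤ p x) (hle : ∀ y ≠ x, p y ≤ q) : IsMixingWeight p q (Pi.single x 1) where
  nonneg y := by
    rw [Pi.single_apply]
    split_ifs <;> norm_num
  sum_eq_one := by simp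
  le_of_ne_zero y hy := by
    rcases eq_or_ne y x with rfl | hyx
    · exact hq
    · exact absurd (Pi.single_eq_of_ne hyx 1) hy
  mul_eq y := by
    rcases eq_or_ne y x with rfl | hyx
    · rw [Pi.single_eq_same, hE, min_eq_right hq]
      ring
    · rw [Pi.single_eq_of_ne hyx, min_eq_left (hle y hyx), zero_mul, sub_self]

end Mixing

section Ranks

variable {n : ℕ} {p : Fin n → ℝ} {q W : ℝ} {σ : Equiv.Perm (Fin n)}

theorem pDown_antitone (p : Fin n → ℝ) : Antitone (pDown p) :=
  fun _ _ h => Tuple.monotone_sort (fun i => OrderDual.toDual (p i)) h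

theorem exists_perm_antitone (p : Fin n → ℝ) : ∃ σ : Equiv.Perm (Fin n), Antitone (p ∘ σ.symm) :=
  ⟨(Tuple.sort fun i => OrderDual.toDual (p i)).symm, pDown_antitone p⟩

theorem pDown_apply_of_antitone (hσ : Antitone (p ∘ σ.symm)) (x : Fin n) :
    pDown p (σ x) = p x := by
  have hsort : (fun i => OrderDual.toDual (p i)) ∘ σ.symm =
      (fun i => OrderDual.toDual (p i)) ∘ Tuple.sort (fun i => OrderDual.toDual (p i)) :=
    Tuple.comp_sort_eq_comp_iff_monotone.2 fun _ _ hij => hσ hij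
  have := congrFun hsort (σ x)
  simp only [Function.comp_apply, Equiv.symm_apply_apply] at this
  exact (OrderDual.toDual.injective this).symm

theorem sum_pDown (p : Fin n → ℝ) : ∑ i, pDown p i = ∑ y, p y := Equiv.sum_comp ..

theorem entropy_pDown (p : Fin n → ℝ) : entropy (pDown p) = entropy p :=
  Equiv.sum_comp _ fun y => Real.negMulLog (p y)

theorem truncErr_pDown (p : Fin n → ℝ) (q : ℝ) : truncErr (pDown p) q = truncErr p q :=
  truncErr_comp_equiv ..

theorem truncEntropy_pDown (p : Fin n → ℝ) (q : ℝ) : truncEntropy (pDown p) q = truncEntropy p q :=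
  truncEntropy_comp_equiv ..

theorem truncErr_eq_sum_Iic_add_sum_Ioi (d : Fin n → ℝ) (q : ℝ) (k : Fin n) :
    truncErr d q =
      ∑ i ∈ Finset.Iic k, min (d i) q + ∑ i ∈ Finset.Ioi k, min (d i) q - q := by
  rw [truncErr, ← Finset.sum_add_sum_compl (Finset.Iic k)]
  congr
  ext
  simp

variable [NeZero n]

theorem le_pDown_zero (p : Fin n → ℝ) (y : Fin n) : p y ≤ pDown p 0 := by
  obtain ⟨σ, hσ⟩ := exists_perm_antitone p
  rw [← pDown_apply_of_antitone hσ y]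
  exact pDown_antitone p (Fin.zero_le _)

theorem truncErr_mem_Icc (hp : p ∈ stdSimplex ℝ (Fin n)) (hq : q ∈ Icc 0 (pDown p 0)) :
    truncErr p q ∈ Icc 0 (1 - pDown p 0) :=
  ⟨truncErr_nonneg hp.1 hq.1 hq.2, truncErr_le_one_sub hp.2 hq.2⟩

theorem truncErr_sub_sum_Ioi_lt_iff {d : Fin n → ℝ} (hd : Antitone d) (hq : q ≤ d 0) {k : Fin n}
    (hk : k ≠ 0) : truncErr d q - ∑ i ∈ Finset.Ioi k, d i < (k : ℕ) * d k ↔ q < d k := by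
  rw [truncErr_eq_sum_Iic_add_sum_Ioi d q k]
  constructor
  · contrapose!
    intro h
    have htail : ∑ i ∈ Finset.Ioi k, min (d i) q = ∑ i ∈ Finset.Ioi k, d i :=
      Finset.sum_congr rfl fun i hi => min_eq_left ((hd (Finset.mem_Ioi.1 hi).le).trans h)
    have hhead := Finset.single_le_sum (f := fun i => min (d i) q - d k)
      (fun i hi => sub_nonneg.2 (le_min (hd (Finset.mem_Iic.1 hi)) h))
      (Finset.mem_Iic.2 (Fin.zero_le k))
    simp only [min_eq_right hq, Finset.sum_sub_distrib, Finset.sum_const, Fin.card_Iic,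
      nsmul_eq_mul, Nat.cast_add, Nat.cast_one] at hhead
    linarith
  · intro h
    have htail : ∑ i ∈ Finset.Ioi k, min (d i) q ≤ ∑ i ∈ Finset.Ioi k, d i :=
      Finset.sum_le_sum fun i _ => min_le_left _ _
    have hhead := Finset.sum_le_card_nsmul (Finset.Iic k) (fun i => min (d i) q) q
      fun i _ => min_le_right _ _
    rw [Fin.card_Iic, nsmul_eq_mul, Nat.cast_add, Nat.cast_one] at hhead
    have hk₀ : (0 : ℝ) < (k : ℕ) := Nat.cast_pos.2 (Nat.pos_of_ne_zero (Fin.val_ne_zero_iff.2 hk))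
    have := mul_lt_mul_of_pos_left h hk₀
    linarith

theorem exists_fanoM_truncErr (hp : ∑ y, p y = 1) (hq : q ≤ pDown p 0)
    (hE : truncErr p q < 1 - pDown p 0) :
    ∃ k : Fin n, k ≠ 0 ∧ fanoM p (truncErr p q) = (k : ℕ) + 1 ∧ ∀ i, i ≤ k ↔ q < pDown p i := by
  have hcond : ∀ k : Fin n, k ≠ 0 →
      ((truncErr p q - ∑ i ∈ Finset.Ioi k, pDown p i) / ((((k : ℕ) + 1 : ℕ) : ℝ) - 1) < pDown p k ↔
        q < pDown p k) := by
    intro k hk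
    have hk₀ : (0 : ℝ) < (k : ℕ) := Nat.cast_pos.2 (Nat.pos_of_ne_zero (Fin.val_ne_zero_iff.2 hk))
    rw [Nat.cast_add, Nat.cast_one, add_sub_cancel_right, div_lt_iff₀ hk₀, mul_comm,
      ← truncErr_pDown, truncErr_sub_sum_Ioi_lt_iff (pDown_antitone p) hq hk]
  obtain ⟨j, hj₀, hj⟩ : ∃ j ≠ 0, q < pDown p j :=
    (truncErr_lt_one_sub_iff ((sum_pDown p).trans hp) hq).1 (by rwa [truncErr_pDown])
  obtain ⟨k, hk, hmax⟩ := Finset.exists_max_image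
    (Finset.univ.filter fun k => k ≠ 0 ∧ q < pDown p k) id ⟨j, by simp [hj₀, hj]⟩
  simp only [Finset.mem_filter, Finset.mem_univ, true_and, id] at hk hmax
  refine ⟨k, hk.1, IsGreatest.csSup_eq ⟨⟨?_, k, rfl, (hcond k hk.1).2 hk.2⟩, ?_⟩, fun i =>
    ⟨fun hi => hk.2.trans_le (pDown_antitone p hi), fun hi => ?_⟩⟩
  · have := Fin.val_ne_zero_iff.2 hk.1
    lia
  · rintro _ ⟨hm, i, rfl, hi⟩
    have hi₀ : i ≠ 0 := Fin.val_ne_zero_iff.1 (by lia)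
    exact Nat.succ_le_succ (hmax i ⟨hi₀, (hcond i hi₀).1 hi⟩)
  · rcases eq_or_ne i 0 with rfl | hi₀
    · exact Fin.zero_le k
    · exact hmax i ⟨hi₀, hi⟩

theorem succ_le_fanoM_truncErr_iff (hp : ∑ y, p y = 1) (hq : q ≤ pDown p 0)
    (hE : truncErr p q < 1 - pDown p 0) (i : Fin n) :
    (i : ℕ) + 1 ≤ fanoM p (truncErr p q) ↔ q < pDown p i := by
  obtain ⟨k, -, hM, hk⟩ := exists_fanoM_truncErr hp hq hE
  rw [hM, Nat.succ_le_succ_iff, ← hk, Fin.le_def]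

theorem fanoLevel_truncErr (hp : ∑ y, p y = 1) (hq : q ≤ pDown p 0)
    (hE : truncErr p q < 1 - pDown p 0) : fanoLevel p (truncErr p q) = q := by
  obtain ⟨k, hk₀, hM, hk⟩ := exists_fanoM_truncErr hp hq hE
  have hfilter : Finset.univ.filter (fun i : Fin n => (k : ℕ) + 1 ≤ (i : ℕ)) = Finset.Ioi k := by
    ext i
    simp [← Fin.val_fin_lt]
  have htail : ∑ i ∈ Finset.Ioi k, min (pDown p i) q = ∑ i ∈ Finset.Ioi k, pDown p i :=
    Finset.sum_congr rfl fun i hi =>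
      min_eq_left (not_lt.1 ((hk i).not.1 (Finset.mem_Ioi.1 hi).not_ge))
  have hhead : ∑ i ∈ Finset.Iic k, min (pDown p i) q = ((k : ℕ) + 1) * q := by
    rw [Finset.sum_congr rfl fun i hi => min_eq_right ((hk i).1 (Finset.mem_Iic.1 hi)).le,
      Finset.sum_const, Fin.card_Iic, nsmul_eq_mul, Nat.cast_add, Nat.cast_one]
  have hk' : ((k : ℕ) : ℝ) ≠ 0 := Nat.cast_ne_zero.2 (Fin.val_ne_zero_iff.2 hk₀)
  rw [fanoLevel, hM, hfilter, ← truncErr_pDown, truncErr_eq_sum_Iic_add_sum_Ioi _ q k, hhead,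
    htail, Nat.cast_add, Nat.cast_one]
  rw [div_eq_iff (by simpa using hk')]
  ring

theorem fanoDist_truncErr (hp : ∑ y, p y = 1) (hq : q ≤ pDown p 0) (r : Fin n) :
    fanoDist p (truncErr p q) r = truncDist (pDown p) q 0 r := by
  rcases lt_or_ge (truncErr p q) (1 - pDown p 0) with hE | hE
  · rw [fanoDist, if_neg (by linarith), fanoLevel_truncErr hp hq hE]
    split_ifs with hr hM
    · rw [hr, truncDist_self, truncErr_pDown]
    · rw [truncDist_of_ne _ _ hr,
        min_eq_right ((succ_le_fanoM_truncErr_iff hp hq hE r).1 hM).le]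
    · rw [truncDist_of_ne _ _ hr,
        min_eq_left (not_lt.1 ((succ_le_fanoM_truncErr_iff hp hq hE r).not.1 hM))]
  · rw [fanoDist, if_pos (by linarith)]
    rw [← truncErr_pDown] at hE
    obtain ⟨hE, hle⟩ := truncErr_eq_one_sub ((sum_pDown p).trans hp) hq hE
    rcases eq_or_ne r 0 with rfl | hr
    · rw [truncDist_self, hE, sub_sub_cancel]
    · rw [truncDist_of_ne _ _ hr, min_eq_left (hle r hr)]

theorem fanoEntropy_truncErr (hp : ∑ y, p y = 1) (hq : q ≤ pDown p 0) :
    fanoEntropy p (truncErr p q) = truncEntropy p q := by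
  rw [fanoEntropy, funext (fanoDist_truncErr hp hq), entropy_truncDist hq, truncEntropy_pDown]

theorem fanoEntropy_of_le (hW : 1 - pDown p 0 ≤ W) : fanoEntropy p W = entropy p := by
  rw [← entropy_pDown]
  exact congrArg entropy (funext fun r => if_pos (show 1 - W ≤ pDown p 0 by linarith))

theorem isMixingWeight_optMarginal (hp : ∑ y, p y = 1) (hq : q ≤ pDown p 0)
    (hσ : Antitone (p ∘ σ.symm)) :
    IsMixingWeight p q (optMarginal p σ (truncErr p q)) := by
  have hrank := pDown_apply_of_antitone hσ
  rcases lt_or_ge (truncErr p q) (1 - pDown p 0) with hE | hE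
  · convert isMixingWeight_div hp (q := q) (by linarith) using 1
    funext x
    rw [optMarginal, if_neg (by linarith), fanoLevel_truncErr hp hq hE, fanoDist_truncErr hp hq,
      truncDist_self, truncErr_pDown]
    split_ifs with hM <;> rw [succ_le_fanoM_truncErr_iff hp hq hE, hrank] at hM
    · rw [min_eq_right hM.le]
    · rw [min_eq_left (not_lt.1 hM), sub_self, zero_div]
  · have hmode : p (σ.symm 0) = pDown p 0 := by rw [← hrank, Equiv.apply_symm_apply]
    rw [← hmode] at hq hE
    obtain ⟨hE, hle⟩ := truncErr_eq_one_sub hp hq hE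
    convert isMixingWeight_single hE hq hle using 1
    funext x
    rw [optMarginal, if_pos (by linarith), Pi.single_apply]
    simp only [Equiv.eq_symm_apply]

theorem optConditional_truncErr (hp : ∑ y, p y = 1) (hσ : Antitone (p ∘ σ.symm)) {x : Fin n}
    (hq : q ≤ p x) (y : Fin n) : optConditional p σ (truncErr p q) x y = truncDist p q x y := by
  have hrank := pDown_apply_of_antitone hσ
  have hq₀ := hq.trans (le_pDown_zero p x)
  rw [optConditional]
  split_ifs with hyx hy
  · rw [hyx, fanoDist_truncErr hp hq₀, truncDist_self, truncDist_self, truncErr_pDown]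
  · have hx : σ x ≠ 0 := fun hx => hyx (σ.injective (hy.trans hx.symm))
    rw [fanoDist_truncErr hp hq₀, truncDist_of_ne _ _ hx, truncDist_of_ne _ _ hyx, hrank,
      min_eq_right hq, ← hrank y, hy, min_eq_right hq₀]
  · rw [fanoDist_truncErr hp hq₀, truncDist_of_ne _ _ hy, truncDist_of_ne _ _ hyx, hrank]

theorem optFinal_truncErr (hp : ∑ y, p y = 1) (hq : q ≤ pDown p 0) (hσ : Antitone (p ∘ σ.symm)) :
    optFinal p σ (truncErr p q) =
      fun x y => optMarginal p σ (truncErr p q) x * truncDist p q x y := by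
  funext x y
  rcases eq_or_ne (optMarginal p σ (truncErr p q) x) 0 with hx | hx
  · rw [optFinal, hx, zero_mul, zero_mul]
  · rw [optFinal, optConditional_truncErr hp hσ
      ((isMixingWeight_optMarginal hp hq hσ).le_of_ne_zero x hx)]

end Ranks

section MinimalError

variable {n : ℕ} [NeZero n] {p : Fin n → ℝ} {W E s : ℝ} {σ : Equiv.Perm (Fin n)}
  {u : Fin n → Fin n → ℝ}

theorem exists_truncErr_eq_of_mem (hp : p ∈ stdSimplex ℝ (Fin n))
    (hW : W ∈ Icc 0 (1 - pDown p 0)) : ∃ q ∈ Icc 0 (pDown p 0), truncErr p q = W :=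
  exists_truncErr_eq hp (le_pDown_zero p) hW

theorem optFinal_nonneg (hp : p ∈ stdSimplex ℝ (Fin n)) (hW : W ∈ Icc 0 (1 - pDown p 0))
    (hσ : Antitone (p ∘ σ.symm)) (x y : Fin n) : 0 ≤ optFinal p σ W x y := by
  obtain ⟨q, hq, rfl⟩ := exists_truncErr_eq_of_mem hp hW
  rw [optFinal_truncErr hp.2 hq.2 hσ]
  exact (isMixingWeight_optMarginal hp.2 hq.2 hσ).mul_truncDist_nonneg hp hq.1 x y

theorem sum_optFinal (hp : p ∈ stdSimplex ℝ (Fin n)) (hW : W ∈ Icc 0 (1 - pDown p 0))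
    (hσ : Antitone (p ∘ σ.symm)) (y : Fin n) : ∑ x, optFinal p σ W x y = p y := by
  obtain ⟨q, hq, rfl⟩ := exists_truncErr_eq_of_mem hp hW
  rw [optFinal_truncErr hp.2 hq.2 hσ]
  exact (isMixingWeight_optMarginal hp.2 hq.2 hσ).sum_mul_truncDist y

theorem sum_optFinal_diag (hp : p ∈ stdSimplex ℝ (Fin n)) (hW : W ∈ Icc 0 (1 - pDown p 0))
    (hσ : Antitone (p ∘ σ.symm)) : ∑ x, optFinal p σ W x x = 1 - W := by
  obtain ⟨q, hq, rfl⟩ := exists_truncErr_eq_of_mem hp hW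
  rw [optFinal_truncErr hp.2 hq.2 hσ]
  exact (isMixingWeight_optMarginal hp.2 hq.2 hσ).sum_mul_truncDist_self

theorem condEntropy_optFinal (hp : p ∈ stdSimplex ℝ (Fin n)) (hW : W ∈ Icc 0 (1 - pDown p 0))
    (hσ : Antitone (p ∘ σ.symm)) : condEntropy (optFinal p σ W) = fanoEntropy p W := by
  obtain ⟨q, hq, rfl⟩ := exists_truncErr_eq_of_mem hp hW
  rw [optFinal_truncErr hp.2 hq.2 hσ, fanoEntropy_truncErr hp.2 hq.2]
  exact (isMixingWeight_optMarginal hp.2 hq.2 hσ).condEntropy_mul_truncDist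

theorem fanoEntropy_mem_Icc (hp : p ∈ stdSimplex ℝ (Fin n)) (hW : W ∈ Icc 0 (1 - pDown p 0)) :
    fanoEntropy p W ∈ Icc 0 (entropy p) := by
  obtain ⟨σ, hσ⟩ := exists_perm_antitone p
  rw [← condEntropy_optFinal hp hW hσ]
  exact ⟨condEntropy_nonneg (optFinal_nonneg hp hW hσ),
    condEntropy_le_entropy hp (optFinal_nonneg hp hW hσ) (sum_optFinal hp hW hσ)⟩

theorem fanoEntropy_zero (hp : p ∈ stdSimplex ℝ (Fin n)) : fanoEntropy p 0 = 0 := by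
  have := fanoEntropy_truncErr hp.2 (q := 0) (hp.1 _)
  rwa [truncErr_zero hp.1, truncEntropy_zero hp.1] at this

theorem condEntropy_lt_fanoEntropy (hp : p ∈ stdSimplex ℝ (Fin n)) (hu : ∀ x y, 0 ≤ u x y)
    (hY : ∀ y, ∑ x, u x y = p y) (hlt : 1 - ∑ x, u x x < E) (hE : E ≤ 1 - pDown p 0) :
    condEntropy u < fanoEntropy p E := by
  have herr := one_sub_sum_diag_nonneg hp.2 hu hY
  have hinterior : ∀ W, 1 - ∑ x, u x x < W → W < 1 - pDown p 0 →
      condEntropy u < fanoEntropy p W := by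
    intro W hlt hW
    obtain ⟨q, hq, rfl⟩ := exists_truncErr_eq_of_mem hp ⟨herr.trans hlt.le, hW.le⟩
    have hq₀ : 0 < q := hq.1.lt_of_ne fun h => by
      rw [← h, truncErr_zero hp.1] at hlt
      exact herr.not_gt hlt
    have hlog : 0 < Real.log ((1 - truncErr p q) / q) :=
      Real.log_pos (by rw [one_lt_div hq₀]; linarith [hq.2])
    have := mul_neg_of_neg_of_pos (show 1 - truncErr p q - ∑ x, u x x < 0 by linarith) hlog
    rw [fanoEntropy_truncErr hp.2 hq.2]
    linarith [condEntropy_le_truncEntropy_add hp hu hY hq₀ hq.2]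
  rcases hE.lt_or_eq with hE | hE
  · exact hinterior E hlt hE
  · obtain ⟨W, hltW, hWE⟩ := exists_between hlt
    have hW := hWE.trans_eq hE
    rw [fanoEntropy_of_le hE.ge]
    exact (hinterior W hltW hW).trans_le
      (fanoEntropy_mem_Icc hp ⟨herr.trans hltW.le, hW.le⟩).2

theorem strictMonoOn_fanoEntropy (hp : p ∈ stdSimplex ℝ (Fin n)) :
    StrictMonoOn (fanoEntropy p) (Icc 0 (1 - pDown p 0)) := by
  intro W hW E hE hWE
  obtain ⟨σ, hσ⟩ := exists_perm_antitone p
  rw [← condEntropy_optFinal hp hW hσ]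
  refine condEntropy_lt_fanoEntropy hp (optFinal_nonneg hp hW hσ) (sum_optFinal hp hW hσ) ?_ hE.2
  rwa [sum_optFinal_diag hp hW hσ, sub_sub_cancel]

theorem bijOn_fanoEntropy (hp : p ∈ stdSimplex ℝ (Fin n)) :
    BijOn (fanoEntropy p) (Icc 0 (1 - pDown p 0)) (Icc 0 (entropy p)) := by
  refine ⟨fun W hW => fanoEntropy_mem_Icc hp hW, (strictMonoOn_fanoEntropy hp).injOn,
    fun s hs => ?_⟩
  rw [← truncEntropy_zero hp.1, ← truncEntropy_of_forall_le hp.2 (le_pDown_zero p)] at hs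
  obtain ⟨q, hq, rfl⟩ :=
    intermediate_value_Icc (hp.1 _) (continuous_truncEntropy p).continuousOn hs
  exact ⟨truncErr p q, truncErr_mem_Icc hp hq, fanoEntropy_truncErr hp.2 hq.2⟩

theorem invOn_Wmin (hp : p ∈ stdSimplex ℝ (Fin n)) :
    InvOn (Wmin p) (fanoEntropy p) (Icc 0 (1 - pDown p 0)) (Icc 0 (entropy p)) :=
  (bijOn_fanoEntropy hp).invOn_invFunOn

theorem Wmin_mem (hp : p ∈ stdSimplex ℝ (Fin n)) (hs : s ∈ Icc 0 (entropy p)) :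
    Wmin p s ∈ Icc 0 (1 - pDown p 0) :=
  (bijOn_fanoEntropy hp).surjOn.mapsTo_invFunOn hs

theorem Wmin_pos (hp : p ∈ stdSimplex ℝ (Fin n)) (hs : s ∈ Ioc 0 (entropy p)) : 0 < Wmin p s := by
  have hs' := Ioc_subset_Icc_self hs
  refine (Wmin_mem hp hs').1.lt_of_ne fun h => hs.1.ne ?_
  rw [← (invOn_Wmin hp).2 hs', ← h, fanoEntropy_zero hp]

theorem Wmin_condEntropy_le (hp : p ∈ stdSimplex ℝ (Fin n)) (hu : ∀ x y, 0 ≤ u x y)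
    (hY : ∀ y, ∑ x, u x y = p y) : Wmin p (condEntropy u) ≤ 1 - ∑ x, u x x := by
  have hmem : condEntropy u ∈ Icc 0 (entropy p) :=
    ⟨condEntropy_nonneg hu, condEntropy_le_entropy hp hu hY⟩
  by_contra! hlt
  have := condEntropy_lt_fanoEntropy hp hu hY hlt (Wmin_mem hp hmem).2
  exact this.ne ((invOn_Wmin hp).2 hmem).symm

end MinimalError

section Analysis

open Filter Topology

theorem absolutelyContinuousOnInterval_comp {f φ : ℝ → ℝ} {a b : ℝ} {s : Set ℝ} {K : NNReal}
    (hf : AbsolutelyContinuousOnInterval f a b) (hφ : LipschitzOnWith K φ s)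
    (hs : MapsTo f (uIcc a b) s) : AbsolutelyContinuousOnInterval (φ ∘ f) a b := by
  rw [absolutelyContinuousOnInterval_iff] at hf ⊢
  intro ε hε
  obtain ⟨δ, hδ, h⟩ := hf (ε / (K + 1)) (by positivity)
  refine ⟨δ, hδ, fun E hE hEδ => ?_⟩
  have hsum := h E hE hEδ
  rw [lt_div_iff₀ (by positivity), Finset.sum_mul] at hsum
  refine (Finset.sum_le_sum fun i hi => ?_).trans_lt hsum
  calc dist (φ (f (E.2 i).1)) (φ (f (E.2 i).2))
      ≤ K * dist (f (E.2 i).1) (f (E.2 i).2) :=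
        hφ.dist_le_mul _ (hs (hE.1 i hi).1) _ (hs (hE.1 i hi).2)
    _ ≤ dist (f (E.2 i).1) (f (E.2 i).2) * (K + 1) := by
        rw [mul_comm]
        gcongr
        exact (lt_add_one _).le

section Primitive

variable {u v : ℝ → ℝ} {τ ε : ℝ}

theorem integral_negMulLog_add (hτ : 0 ≤ τ) (hv : IntervalIntegrable v volume 0 τ)
    (hu : ∀ t ∈ Icc 0 τ, u t = u 0 + ∫ s in (0 : ℝ)..t, v s) (hu₀ : ∀ t ∈ Icc 0 τ, 0 ≤ u t)
    (hε : 0 < ε) :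
    ∫ t in (0 : ℝ)..τ, (-Real.log (u t + ε) - 1) * v t =
      Real.negMulLog (u τ + ε) - Real.negMulLog (u 0 + ε) := by
  have hIcc : uIcc 0 τ = Icc 0 τ := uIcc_of_le hτ
  set U : ℝ → ℝ := fun t => (∫ s in (0 : ℝ)..t, v s) + (u 0 + ε) with hU
  have hUu : ∀ t ∈ Icc 0 τ, U t = u t + ε := fun t ht => by
    rw [hu t ht, hU]
    ring
  have hUac : AbsolutelyContinuousOnInterval U 0 τ :=
    (hv.absolutelyContinuousOnInterval_intervalIntegral left_mem_uIcc).fun_add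
      (LipschitzWith.const (u 0 + ε)).lipschitzOnWith.absolutelyContinuousOnInterval
  obtain ⟨C, hC⟩ := hUac.exists_bound
  have hmaps : MapsTo U (uIcc 0 τ) (Icc ε C) := fun t ht => by
    refine ⟨?_, (le_abs_self _).trans (hC t ht)⟩
    rw [hIcc] at ht
    rw [hUu t ht]
    linarith [hu₀ t ht]
  have hcd : ContDiffOn ℝ 1 Real.negMulLog (Icc ε C) :=
    contDiffOn_id.neg.mul (contDiffOn_id.log fun x hx => (hε.trans_le hx.1).ne')
  obtain ⟨K, hK⟩ := hcd.exists_lipschitzOnWith one_ne_zero (convex_Icc _ _) isCompact_Icc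
  have hftc := (absolutelyContinuousOnInterval_comp hUac hK hmaps).integral_deriv_eq_sub
  rw [Function.comp_apply, Function.comp_apply, hUu τ ⟨hτ, le_rfl⟩, hUu 0 ⟨le_rfl, hτ⟩] at hftc
  rw [← hftc]
  refine intervalIntegral.integral_congr_ae ?_
  filter_upwards [hv.ae_hasDerivAt_integral] with t ht htm
  replace htm : t ∈ uIcc 0 τ := uIoc_subset_uIcc htm
  have hderiv : HasDerivAt U (v t) t := (ht htm 0 left_mem_uIcc).add_const _
  have hpos : U t ≠ 0 := (hε.trans_le (hmaps htm).1).ne'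
  rw [((Real.hasDerivAt_negMulLog hpos).comp t hderiv).deriv, hUu t (hIcc ▸ htm)]

theorem ae_eq_zero_of_eq_zero (hτ : 0 ≤ τ) (hv : IntervalIntegrable v volume 0 τ)
    (hu : ∀ t ∈ Icc 0 τ, u t = u 0 + ∫ s in (0 : ℝ)..t, v s) (hu₀ : ∀ t ∈ Icc 0 τ, 0 ≤ u t) :
    ∀ᵐ t ∂(volume.restrict (Ioc 0 τ)), u t = 0 → v t = 0 := by
  rw [ae_restrict_iff' measurableSet_Ioc]
  filter_upwards [hv.ae_hasDerivAt_integral, Measure.ae_ne volume τ] with t ht htτ htm hzero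
  have htm' : t ∈ Ioo 0 τ := ⟨htm.1, lt_of_le_of_ne htm.2 htτ⟩
  have hderiv := ht (by rw [uIcc_of_le hτ]; exact Ioc_subset_Icc_self htm) 0 left_mem_uIcc
  -- `t` is an interior minimum of `u`
  refine IsLocalMin.hasDerivAt_eq_zero ?_ hderiv
  filter_upwards [isOpen_Ioo.mem_nhds htm'] with s hs
  linarith [hu t (Ioo_subset_Icc_self htm'), hu s (Ioo_subset_Icc_self hs),
    hu₀ s (Ioo_subset_Icc_self hs)]

end Primitive

section Integral

variable {α : Type*} [MeasurableSpace α] {μ : Measure α}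

theorem integrable_of_tendsto_of_tendsto_integral {F : ℕ → α → ℝ} {f : α → ℝ} {S : ℝ}
    (hF : ∀ k, Integrable (F k) μ) (hF₀ : ∀ k, ∀ᵐ t ∂μ, 0 ≤ F k t)
    (hlim : ∀ᵐ t ∂μ, Tendsto (fun k => F k t) atTop (𝓝 (f t)))
    (hS : Tendsto (fun k => ∫ t, F k t ∂μ) atTop (𝓝 S)) : Integrable f μ := by
  refine ⟨aestronglyMeasurable_of_tendsto_ae _ (fun k => (hF k).aestronglyMeasurable) hlim, ?_⟩
  have hnorm : ∀ k, ∫⁻ t, ‖F k t‖ₑ ∂μ = ENNReal.ofReal (∫ t, F k t ∂μ) := fun k => by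
    rw [ofReal_integral_eq_lintegral_ofReal (hF k) (hF₀ k)]
    exact lintegral_congr_ae ((hF₀ k).mono fun t => Real.enorm_of_nonneg)
  calc ∫⁻ t, ‖f t‖ₑ ∂μ
      ≤ ∫⁻ t, liminf (fun k => ‖F k t‖ₑ) atTop ∂μ :=
        lintegral_mono_ae (hlim.mono fun t ht => ht.enorm.liminf_eq.ge)
    _ ≤ liminf (fun k => ∫⁻ t, ‖F k t‖ₑ ∂μ) atTop :=
        lintegral_liminf_le' fun k => (hF k).aestronglyMeasurable.aemeasurable.enorm
    _ = ENNReal.ofReal S := by simp only [hnorm, (ENNReal.tendsto_ofReal hS).liminf_eq]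
    _ < ⊤ := ENNReal.ofReal_lt_top

/-- The limit `f` is not assumed to be integrable: Fatou's lemma for `F k + g` shows that it is,
and then `f + g` dominates. -/
theorem integrable_and_integral_eq_of_tendsto {F : ℕ → α → ℝ} {f g : α → ℝ} {S : ℝ}
    (hF : ∀ k, Integrable (F k) μ) (hg : Integrable g μ)
    (hmem : ∀ k, ∀ᵐ t ∂μ, F k t ∈ Icc (-g t) (f t + g t))
    (hlim : ∀ᵐ t ∂μ, Tendsto (fun k => F k t) atTop (𝓝 (f t)))
    (hS : Tendsto (fun k => ∫ t, F k t ∂μ) atTop (𝓝 S)) :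
    Integrable f μ ∧ ∫ t, f t ∂μ = S := by
  have hfg : Integrable (fun t => f t + g t) μ := by
    refine integrable_of_tendsto_of_tendsto_integral (F := fun k t => F k t + g t)
      (S := S + ∫ t, g t ∂μ) (fun k => (hF k).add hg) (fun k => ?_) ?_ ?_
    · filter_upwards [hmem k] with t ht
      linarith [ht.1]
    · filter_upwards [hlim] with t ht
      exact ht.add_const _
    · simpa only [integral_add (hF _) hg] using hS.add_const _
  have hf : Integrable f μ := (hfg.sub hg).congr (.of_forall fun t => add_sub_cancel_right _ _)
  refine ⟨hf, tendsto_nhds_unique ?_ hS⟩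
  refine tendsto_integral_of_dominated_convergence (fun t => |f t| + |g t|)
    (fun k => (hF k).aestronglyMeasurable) (hf.abs.add hg.abs) (fun k => ?_) hlim
  filter_upwards [hmem k] with t ht
  rw [Real.norm_eq_abs, abs_le]
  constructor <;>
    linarith [ht.1, ht.2, le_abs_self (f t), le_abs_self (g t), abs_nonneg (f t)]

theorem sq_integral_le_integral_mul_integral {f m d : α → ℝ} (hf : Integrable f μ)
    (hm : Integrable m μ) (hd : Integrable d μ) (hm₀ : 0 ≤ᵐ[μ] m) (hd₀ : 0 ≤ᵐ[μ] d)
    (h : ∀ᵐ t ∂μ, f t ^ 2 ≤ m t * d t) :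
    (∫ t, f t ∂μ) ^ 2 ≤ (∫ t, m t ∂μ) * ∫ t, d t ∂μ := by
  have hquad : ∀ r : ℝ, 0 ≤ (∫ t, m t ∂μ) * (r * r) + 2 * (∫ t, f t ∂μ) * r + ∫ t, d t ∂μ := by
    intro r
    calc 0 ≤ ∫ t, (m t * (r * r) + 2 * f t * r + d t) ∂μ := by
          refine integral_nonneg_of_ae ?_
          filter_upwards [hm₀, hd₀, h] with t hm₀ hd₀ h
          simp only [Pi.zero_apply] at hm₀ hd₀ ⊢
          rcases hm₀.eq_or_lt with hm | hm
          · have : f t = 0 := by nlinarith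
            simpa [← hm, this] using hd₀
          · have : 0 ≤ (m t * r + f t) ^ 2 + (m t * d t - f t ^ 2) := by nlinarith
            exact nonneg_of_mul_nonneg_right (this.trans_eq (by ring)) hm
      _ = _ := by
          have hm' := hm.mul_const (r * r)
          have hf' := (hf.const_mul 2).mul_const r
          rw [integral_add (by exact hm'.add hf') hd, integral_add hm' hf', integral_mul_const,
            integral_mul_const, integral_const_mul]
  have hdiscrim := discrim_le_zero hquad
  rw [discrim] at hdiscrim
  linarith

end Integral

section LogRatio

theorem log_add_sub_log_add_mem_uIcc {a b ε : ℝ} (ha : 0 < a) (hb : 0 < b) (hε : 0 ≤ ε) :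
    Real.log (a + ε) - Real.log (b + ε) ∈ uIcc 0 (Real.log a - Real.log b) := by
  wlog hba : b ≤ a generalizing a b
  · have := this hb ha (le_of_not_ge hba)
    rw [uIcc_comm, mem_uIcc] at this
    rw [mem_uIcc]
    rcases this with h | h
    · exact .inl ⟨by linarith [h.2], by linarith [h.1]⟩
    · exact .inr ⟨by linarith [h.2], by linarith [h.1]⟩
  have hlower : 0 ≤ Real.log (a + ε) - Real.log (b + ε) :=
    sub_nonneg.2 (Real.log_le_log (by positivity) (by linarith))
  have hupper : Real.log (a + ε) - Real.log (b + ε) ≤ Real.log a - Real.log b := by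
    rw [← Real.log_div (by positivity) (by positivity), ← Real.log_div ha.ne' hb.ne']
    refine Real.log_le_log (by positivity) ?_
    rw [div_le_div_iff₀ (by positivity) hb]
    nlinarith
  exact mem_uIcc_of_le hlower hupper

theorem add_mem_Icc_of_mem_uIcc {a b c : ℝ} (hab : 0 ≤ a + b) (hc : c ∈ uIcc 0 b) :
    a + c ∈ Icc (-|a|) (a + b + |a|) := by
  rcases mem_uIcc.1 hc with hc | hc <;> constructor <;>
    linarith [hc.1, hc.2, neg_abs_le a, le_abs_self a]

end LogRatio

end Analysis

section Antisymmetric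

variable {ι : Type*} [Fintype ι] {J : ι → ι → ℝ}

theorem sum_sum_eq_zero_of_antisymm (hJ : ∀ x x', J x' x = -J x x') : ∑ x, ∑ x', J x x' = 0 := by
  have : ∑ x, ∑ x', J x x' = -∑ x, ∑ x', J x x' := by
    conv_lhs => rw [Finset.sum_comm]
    simp only [← Finset.sum_neg_distrib, ← hJ]
  linarith

theorem sum_sum_antisymm_mul_sub (hJ : ∀ x x', J x' x = -J x x') (g : ι → ℝ) :
    ∑ x, ∑ x', J x x' * (g x' - g x) = 2 * ∑ x, (-g x - 1) * ∑ x', J x x' := by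
  have hswap : ∑ x, ∑ x', J x x' * g x' = -∑ x, ∑ x', J x x' * g x := by
    rw [Finset.sum_comm, ← Finset.sum_neg_distrib]
    refine Finset.sum_congr rfl fun x _ => ?_
    rw [← Finset.sum_neg_distrib]
    exact Finset.sum_congr rfl fun x' _ => by rw [hJ x x', neg_mul]
  have hzero := sum_sum_eq_zero_of_antisymm hJ
  simp only [mul_sub, sub_mul, Finset.sum_sub_distrib, hswap, one_mul, neg_mul, hzero,
    Finset.sum_neg_distrib, Finset.mul_sum]
  simp only [mul_comm (g _)]
  ring

end Antisymmetric

section Rates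

variable {n : ℕ} (R : ℝ → Fin n → Fin n → Fin n → ℝ) (p : ℝ → Fin n → Fin n → ℝ)

theorem current_swap (t : ℝ) (y x x' : Fin n) : current R p t y x' x = -current R p t y x x' :=
  (neg_sub _ _).symm

/-- The sum of current times force over all ordered transitions: twice the rate of total entropy
production. -/
noncomputable def dissipationRate (t : ℝ) : ℝ :=
  ∑ y, ∑ x, ∑ x', current R p t y x x' * force R p t y x x'

/-- The dissipation rate with `p + ε` in place of `p` in the thermodynamic force, which makes the
chain rule for the entropy available where `p` vanishes. -/
noncomputable def regDissipationRate (ε t : ℝ) : ℝ := ∑ y, ∑ x, ∑ x',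
  (current R p t y x x' * Real.log (R t y x x' / R t y x' x) +
    current R p t y x x' * (Real.log (p t x' y + ε) - Real.log (p t x y + ε)))

end Rates

namespace FeedbackProcess

open Filter Topology

variable {n : ℕ} {G : Fin n → SimpleGraph (Fin n)} {pY : Fin n → ℝ} {β τ : ℝ}
  (P : FeedbackProcess G pY β τ)

section Conservation

theorem flux_nonneg {t : ℝ} (ht : t ∈ Icc 0 τ) (y x x' : Fin n) : 0 ≤ flux P.rate P.prob t y x x' :=
  mul_nonneg (P.rate_nonneg t y x x') (P.prob_nonneg t ht x' y)

theorem flux_self (t : ℝ) (y x : Fin n) : flux P.rate P.prob t y x x = 0 := by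
  rw [flux, P.rate_eq_zero t y x x (G y).irrefl, zero_mul]

theorem current_integrable (y x x' : Fin n) :
    IntervalIntegrable (fun t => current P.rate P.prob t y x x') volume 0 τ :=
  (P.flux_integrable y x x').sub (P.flux_integrable y x' x)

theorem sum_current_integrable (x y : Fin n) :
    IntervalIntegrable (fun t => ∑ x', current P.rate P.prob t y x x') volume 0 τ :=
  ⟨integrable_finsetSum _ fun x' _ => (P.current_integrable y x x').1,
    integrable_finsetSum _ fun x' _ => (P.current_integrable y x x').2⟩

theorem prob_eq {t : ℝ} (ht : t ∈ Icc 0 τ) (x y : Fin n) : P.prob t x y = P.prob 0 x y +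
    ∫ s in (0 : ℝ)..t, ∑ x', current P.rate P.prob s y x x' :=
  P.master t ht x y

theorem continuousOn_prob (hτ : 0 ≤ τ) (x y : Fin n) :
    ContinuousOn (fun t => P.prob t x y) (uIcc 0 τ) := by
  have h := intervalIntegral.continuousOn_primitive_interval' (P.sum_current_integrable x y)
    left_mem_uIcc
  refine (h.const_add (P.prob 0 x y)).congr fun t ht => ?_
  exact P.prob_eq (by rwa [uIcc_of_le hτ] at ht) x y

theorem continuousOn_log_prob_add (hτ : 0 ≤ τ) {ε : ℝ} (hε : 0 < ε) (x y : Fin n) :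
    ContinuousOn (fun t => Real.log (P.prob t x y + ε)) (uIcc 0 τ) := by
  refine ((P.continuousOn_prob hτ x y).add continuousOn_const).log fun t ht => ?_
  rw [uIcc_of_le hτ] at ht
  exact (add_pos_of_nonneg_of_pos (P.prob_nonneg t ht x y) hε).ne'

theorem sum_prob {t : ℝ} (ht : t ∈ Icc 0 τ) (y : Fin n) : ∑ x, P.prob t x y = pY y := by
  have hsub : uIcc 0 t ⊆ uIcc 0 τ :=
    uIcc_subset_uIcc_left (by rwa [uIcc_of_le (ht.1.trans ht.2)])
  have hnet : ∑ x, ∫ s in (0 : ℝ)..t, ∑ x', current P.rate P.prob s y x x' = 0 := by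
    rw [← intervalIntegral.integral_finsetSum fun x _ =>
      (P.sum_current_integrable x y).mono_set hsub]
    simp only [sum_sum_eq_zero_of_antisymm fun x x' => current_swap P.rate P.prob _ y x x',
      intervalIntegral.integral_zero]
  rw [Finset.sum_congr rfl fun x _ => P.prob_eq ht x y, Finset.sum_add_distrib, hnet, add_zero]
  simp [P.prob_zero]

end Conservation

section Information

theorem condEntropy_prob_zero : condEntropy (P.prob 0) = 0 :=
  condEntropy_eq_zero_of_diag fun x y h => by rw [P.prob_zero, if_neg h]

theorem mutualInfo_eq {t : ℝ} (ht : t ∈ Icc 0 τ) :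
    P.mutualInfo t = entropy pY - condEntropy (P.prob t) := by
  have hY : P.probY t = pY := funext fun y => P.sum_prob ht y
  rw [mutualInfo, hY, condEntropy]
  unfold probX
  ring

theorem abs_deltaI (hτ : 0 ≤ τ) : |P.deltaI| = condEntropy (P.prob τ) := by
  have hdeltaI : P.deltaI = -condEntropy (P.prob τ) := by
    rw [deltaI, P.mutualInfo_eq ⟨hτ, le_rfl⟩, P.mutualInfo_eq ⟨le_rfl, hτ⟩, condEntropy_prob_zero]
    ring
  rw [hdeltaI, abs_neg, abs_of_nonneg (condEntropy_nonneg (P.prob_nonneg τ ⟨hτ, le_rfl⟩))]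

/-- The total entropy production, with the entropy of the joint distribution in place of that of
the `X`-marginal. -/
noncomputable def entropyProduction : ℝ :=
  entropy (fun z : Fin n × Fin n => P.prob τ z.1 z.2) -
    entropy (fun z : Fin n × Fin n => P.prob 0 z.1 z.2) - β * P.totalHeat

theorem entropyProduction_eq_sum : P.entropyProduction =
    ∑ y, ∑ x, (Real.negMulLog (P.prob τ x y) - Real.negMulLog (P.prob 0 x y)) -
      β * P.totalHeat := by
  rw [Finset.sum_comm, entropyProduction, entropy, entropy, Fintype.sum_prod_type,
    Fintype.sum_prod_type]
  simp only [Finset.sum_sub_distrib]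

theorem entropyProductionX_eq (hτ : 0 ≤ τ) :
    P.entropyProductionX = -|P.deltaI| + P.entropyProduction := by
  have hzero := P.condEntropy_prob_zero
  rw [P.abs_deltaI hτ, entropyProductionX, entropyProduction]
  unfold condEntropy probX at *
  linarith

end Information

section Dissipation

theorem ae_pos_of_flux_ne_zero (hτ : 0 ≤ τ) : ∀ᵐ t ∂(volume.restrict (Ioc 0 τ)), ∀ y x x',
    flux P.rate P.prob t y x x' ≠ 0 → 0 < P.rate t y x x' ∧ 0 < P.rate t y x' x ∧
      0 < P.prob t x y ∧ 0 < P.prob t x' y := by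
  have hnet : ∀ᵐ t ∂(volume.restrict (Ioc 0 τ)), ∀ x y, P.prob t x y = 0 →
      ∑ x', current P.rate P.prob t y x x' = 0 :=
    ae_all_iff.2 fun x => ae_all_iff.2 fun y =>
      -- where `p (x, y)` vanishes it is minimal, so that the net inflow is zero
      ae_eq_zero_of_eq_zero hτ (P.sum_current_integrable x y) (fun t ht => P.prob_eq ht x y)
        fun t ht => P.prob_nonneg t ht x y
  filter_upwards [hnet, ae_restrict_mem measurableSet_Ioc] with t hnet ht y x x' hne
  replace ht := Ioc_subset_Icc_self ht
  have hrate : P.rate t y x x' ≠ 0 := left_ne_zero_of_mul hne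
  refine ⟨(P.rate_nonneg t y x x').lt_of_ne' hrate,
    (P.rate_nonneg t y x' x).lt_of_ne' fun h => hrate (P.rate_bidirectional t y x' x h),
    (P.prob_nonneg t ht x y).lt_of_ne' fun h => hne ?_,
    (P.prob_nonneg t ht x' y).lt_of_ne' (right_ne_zero_of_mul hne)⟩
  have hin : ∀ x'', current P.rate P.prob t y x x'' = flux P.rate P.prob t y x x'' := fun x'' => by
    rw [current, flux, flux, h, mul_zero, sub_zero]
  have hsum := hnet x y h
  simp only [hin] at hsum
  exact (Finset.sum_eq_zero_iff_of_nonneg fun x'' _ => P.flux_nonneg ht y x x'').1 hsum x'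
    (Finset.mem_univ x')

theorem ae_pos_or_flux_eq_zero (hτ : 0 ≤ τ) : ∀ᵐ t ∂(volume.restrict (Ioc 0 τ)), ∀ y x x',
    (0 < P.rate t y x x' ∧ 0 < P.rate t y x' x ∧ 0 < P.prob t x y ∧ 0 < P.prob t x' y) ∨
    (flux P.rate P.prob t y x x' = 0 ∧ flux P.rate P.prob t y x' x = 0) := by
  filter_upwards [P.ae_pos_of_flux_ne_zero hτ] with t ht y x x'
  by_cases h : flux P.rate P.prob t y x x' = 0
  · by_cases h' : flux P.rate P.prob t y x' x = 0
    · exact .inr ⟨h, h'⟩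
    · obtain ⟨hr, hr', hp, hp'⟩ := ht y x' x h'
      exact .inl ⟨hr', hr, hp', hp⟩
  · exact .inl (ht y x x' h)

theorem ae_flux_pos_or_eq_zero (hτ : 0 ≤ τ) : ∀ᵐ t ∂(volume.restrict (Ioc 0 τ)), ∀ y x x',
    (0 < flux P.rate P.prob t y x x' ∧ 0 < flux P.rate P.prob t y x' x) ∨
    (flux P.rate P.prob t y x x' = 0 ∧ flux P.rate P.prob t y x' x = 0) := by
  filter_upwards [P.ae_pos_or_flux_eq_zero hτ] with t ht y x x'
  exact (ht y x x').imp_left fun ⟨hr, hr', hp, hp'⟩ => ⟨mul_pos hr hp', mul_pos hr' hp⟩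

theorem ae_current_mul_force_nonneg (hτ : 0 ≤ τ) : ∀ᵐ t ∂(volume.restrict (Ioc 0 τ)), ∀ y x x',
    0 ≤ current P.rate P.prob t y x x' * force P.rate P.prob t y x x' := by
  filter_upwards [P.ae_flux_pos_or_eq_zero hτ] with t ht y x x'
  rw [current, force]
  rcases ht y x x' with ⟨hj, hj'⟩ | ⟨hj, hj'⟩
  · rw [Real.log_div hj.ne' hj'.ne']
    rcases le_total (flux P.rate P.prob t y x x') (flux P.rate P.prob t y x' x) with h | h
    · exact mul_nonneg_of_nonpos_of_nonpos (sub_nonpos.2 h)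
        (sub_nonpos.2 (Real.log_le_log hj h))
    · exact mul_nonneg (sub_nonneg.2 h) (sub_nonneg.2 (Real.log_le_log hj' h))
  · simp [hj, hj']

theorem ae_dissipationRate_nonneg (hτ : 0 ≤ τ) :
    0 ≤ᵐ[volume.restrict (Ioc 0 τ)] dissipationRate P.rate P.prob := by
  filter_upwards [P.ae_current_mul_force_nonneg hτ] with t ht
  exact Finset.sum_nonneg fun y _ => Finset.sum_nonneg fun x _ => Finset.sum_nonneg fun x' _ =>
    ht y x x'

theorem ae_current_mul_force_eq (hτ : 0 ≤ τ) : ∀ᵐ t ∂(volume.restrict (Ioc 0 τ)), ∀ y x x',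
    current P.rate P.prob t y x x' * force P.rate P.prob t y x x' =
      current P.rate P.prob t y x x' * Real.log (P.rate t y x x' / P.rate t y x' x) +
        current P.rate P.prob t y x x' *
          (Real.log (P.prob t x' y) - Real.log (P.prob t x y)) := by
  filter_upwards [P.ae_pos_or_flux_eq_zero hτ] with t ht y x x'
  rcases ht y x x' with ⟨hr, hr', hp, hp'⟩ | ⟨hj, hj'⟩
  · rw [force, flux, flux, mul_div_mul_comm, Real.log_mul (div_pos hr hr').ne' (div_pos hp' hp).ne',
      Real.log_div hp'.ne' hp.ne', mul_add]
  · simp [current, hj, hj']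

theorem ae_current_mul_log_add_mem_uIcc (hτ : 0 ≤ τ) {ε : ℝ} (hε : 0 ≤ ε) :
    ∀ᵐ t ∂(volume.restrict (Ioc 0 τ)), ∀ y x x', current P.rate P.prob t y x x' *
        (Real.log (P.prob t x' y + ε) - Real.log (P.prob t x y + ε)) ∈
      uIcc 0 (current P.rate P.prob t y x x' *
        (Real.log (P.prob t x' y) - Real.log (P.prob t x y))) := by
  filter_upwards [P.ae_pos_or_flux_eq_zero hτ] with t ht y x x'
  rcases ht y x x' with ⟨-, -, hp, hp'⟩ | ⟨hj, hj'⟩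
  · have := mem_image_of_mem (current P.rate P.prob t y x x' * ·)
      (log_add_sub_log_add_mem_uIcc hp' hp hε)
    rwa [Set.image_const_mul_uIcc, mul_zero] at this
  · simp [current, hj, hj']

theorem ae_tendsto_current_mul_log_add (hτ : 0 ≤ τ) {ε : ℕ → ℝ} (hε : Tendsto ε atTop (𝓝 0)) :
    ∀ᵐ t ∂(volume.restrict (Ioc 0 τ)), ∀ y x x', Tendsto (fun k => current P.rate P.prob t y x x' *
        (Real.log (P.prob t x' y + ε k) - Real.log (P.prob t x y + ε k))) atTop
      (𝓝 (current P.rate P.prob t y x x' *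
        (Real.log (P.prob t x' y) - Real.log (P.prob t x y)))) := by
  filter_upwards [P.ae_pos_or_flux_eq_zero hτ] with t ht y x x'
  rcases ht y x x' with ⟨-, -, hp, hp'⟩ | ⟨hj, hj'⟩
  · have hlog : ∀ {a : ℝ}, 0 < a → Tendsto (fun k => Real.log (a + ε k)) atTop (𝓝 (Real.log a)) :=
      fun {a} ha => Tendsto.log (by simpa using hε.const_add a) ha.ne'
    exact ((hlog hp').sub (hlog hp)).const_mul _
  · simp [current, hj, hj']

theorem current_mul_log_rate (hβ : β ≠ 0) (t : ℝ) (y x x' : Fin n) :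
    current P.rate P.prob t y x x' * Real.log (P.rate t y x x' / P.rate t y x' x) =
      -β * (heat P.rate β t y x x' * flux P.rate P.prob t y x x' +
        heat P.rate β t y x' x * flux P.rate P.prob t y x' x) := by
  have hinv : Real.log (P.rate t y x' x / P.rate t y x x') =
      -Real.log (P.rate t y x x' / P.rate t y x' x) := by rw [← Real.log_inv, inv_div]
  rw [heat, heat, hinv, current]
  field_simp
  ring

theorem current_mul_log_rate_integrable (hβ : β ≠ 0) (y x x' : Fin n) :
    IntervalIntegrable (fun t => current P.rate P.prob t y x x' *
      Real.log (P.rate t y x x' / P.rate t y x' x)) volume 0 τ := by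
  simp only [P.current_mul_log_rate hβ]
  exact ((P.heat_integrable y x x').add (P.heat_integrable y x' x)).const_mul _

theorem current_mul_log_add_integrable (hτ : 0 ≤ τ) {ε : ℝ} (hε : 0 < ε) (y x x' : Fin n) :
    IntervalIntegrable (fun t => current P.rate P.prob t y x x' *
      (Real.log (P.prob t x' y + ε) - Real.log (P.prob t x y + ε))) volume 0 τ :=
  (P.current_integrable y x x').mul_continuousOn
    ((P.continuousOn_log_prob_add hτ hε x' y).sub (P.continuousOn_log_prob_add hτ hε x y))

theorem regDissipationRate_integrable (hβ : β ≠ 0) (hτ : 0 ≤ τ) {ε : ℝ} (hε : 0 < ε) :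
    IntegrableOn (regDissipationRate P.rate P.prob ε) (Ioc 0 τ) :=
  integrable_finsetSum _ fun y _ => integrable_finsetSum _ fun x _ => integrable_finsetSum _
    fun x' _ => (P.current_mul_log_rate_integrable hβ y x x').1.add
      (P.current_mul_log_add_integrable hτ hε y x x').1

theorem regDissipationRate_eq (hβ : β ≠ 0) (ε t : ℝ) :
    regDissipationRate P.rate P.prob ε t =
      2 * (∑ y, ∑ x, (-Real.log (P.prob t x y + ε) - 1) * ∑ x', current P.rate P.prob t y x x') -
      2 * β * ∑ y, ∑ x, ∑ x', heat P.rate β t y x x' * flux P.rate P.prob t y x x' := by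
  have hheat : ∀ y, ∑ x, ∑ x', current P.rate P.prob t y x x' *
        Real.log (P.rate t y x x' / P.rate t y x' x) =
      -(2 * β) * ∑ x, ∑ x', heat P.rate β t y x x' * flux P.rate P.prob t y x x' := by
    intro y
    simp only [P.current_mul_log_rate hβ, ← Finset.mul_sum, Finset.sum_add_distrib]
    rw [Finset.sum_comm (f := fun x x' => heat P.rate β t y x' x * flux P.rate P.prob t y x' x)]
    ring
  have hlog := fun y => sum_sum_antisymm_mul_sub
    (fun x x' => current_swap P.rate P.prob t y x x') fun x => Real.log (P.prob t x y + ε)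
  simp only [regDissipationRate, Finset.sum_add_distrib, hheat, hlog, ← Finset.mul_sum]
  ring

theorem integral_regDissipationRate (hβ : β ≠ 0) (hτ : 0 ≤ τ) {ε : ℝ} (hε : 0 < ε) :
    ∫ t in Ioc 0 τ, regDissipationRate P.rate P.prob ε t =
      2 * (∑ y, ∑ x, (Real.negMulLog (P.prob τ x y + ε) - Real.negMulLog (P.prob 0 x y + ε)) -
        β * P.totalHeat) := by
  have hint : ∀ y x, IntegrableOn (fun t => (-Real.log (P.prob t x y + ε) - 1) *
      ∑ x', current P.rate P.prob t y x x') (Ioc 0 τ) := fun y x =>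
    ((P.sum_current_integrable x y).continuousOn_mul
      ((P.continuousOn_log_prob_add hτ hε x y).neg.sub continuousOn_const)).1
  have hheat : IntegrableOn (fun t => ∑ y, ∑ x, ∑ x',
      heat P.rate β t y x x' * flux P.rate P.prob t y x x') (Ioc 0 τ) :=
    integrable_finsetSum _ fun y _ => integrable_finsetSum _ fun x _ => integrable_finsetSum _
      fun x' _ => (P.heat_integrable y x x').1
  have hlog : ∀ y x, ∫ t in Ioc 0 τ, (-Real.log (P.prob t x y + ε) - 1) *
      ∑ x', current P.rate P.prob t y x x' =
        Real.negMulLog (P.prob τ x y + ε) - Real.negMulLog (P.prob 0 x y + ε) := fun y x => by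
    rw [← intervalIntegral.integral_of_le hτ]
    exact integral_negMulLog_add hτ (P.sum_current_integrable x y) (fun t ht => P.prob_eq ht x y)
      (fun t ht => P.prob_nonneg t ht x y) hε
  simp only [P.regDissipationRate_eq hβ]
  rw [integral_sub ((integrable_finsetSum _ fun y _ => integrable_finsetSum _ fun x _ =>
      hint y x).const_mul 2) (hheat.const_mul _), integral_const_mul, integral_const_mul,
    integral_finsetSum _ fun y _ => integrable_finsetSum _ fun x _ => hint y x, totalHeat,
    intervalIntegral.integral_of_le hτ]
  simp only [integral_finsetSum _ fun x _ => hint _ x, hlog]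
  ring

theorem ae_regDissipationRate_mem_Icc (hτ : 0 ≤ τ) {ε : ℝ} (hε : 0 ≤ ε) :
    ∀ᵐ t ∂(volume.restrict (Ioc 0 τ)), regDissipationRate P.rate P.prob ε t ∈
      Icc (-∑ y, ∑ x, ∑ x',
          |current P.rate P.prob t y x x' * Real.log (P.rate t y x x' / P.rate t y x' x)|)
        (dissipationRate P.rate P.prob t + ∑ y, ∑ x, ∑ x',
          |current P.rate P.prob t y x x' * Real.log (P.rate t y x x' / P.rate t y x' x)|) := by
  filter_upwards [P.ae_current_mul_force_eq hτ, P.ae_current_mul_force_nonneg hτ,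
    P.ae_current_mul_log_add_mem_uIcc hτ hε] with t heq hnonneg hmem
  have hterm := fun y x x' =>
    add_mem_Icc_of_mem_uIcc ((hnonneg y x x').trans_eq (heq y x x')) (hmem y x x')
  simp only [← heq] at hterm
  simp only [regDissipationRate, dissipationRate, ← Finset.sum_neg_distrib,
    ← Finset.sum_add_distrib]
  exact ⟨Finset.sum_le_sum fun y _ => Finset.sum_le_sum fun x _ => Finset.sum_le_sum fun x' _ =>
      (hterm y x x').1, Finset.sum_le_sum fun y _ => Finset.sum_le_sum fun x _ =>
    Finset.sum_le_sum fun x' _ => (hterm y x x').2⟩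

theorem integrable_and_integral_dissipationRate (hβ : β ≠ 0) (hτ : 0 ≤ τ) :
    IntegrableOn (dissipationRate P.rate P.prob) (Ioc 0 τ) ∧
      ∫ t in Ioc 0 τ, dissipationRate P.rate P.prob t = 2 * P.entropyProduction := by
  have hε : ∀ k : ℕ, (0 : ℝ) < 1 / ((k : ℝ) + 1) := fun k => Nat.one_div_pos_of_nat
  have hε₀ : Tendsto (fun k : ℕ => 1 / ((k : ℝ) + 1)) atTop (𝓝 0) :=
    tendsto_one_div_add_atTop_nhds_zero_nat
  refine integrable_and_integral_eq_of_tendsto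
    (fun k => P.regDissipationRate_integrable hβ hτ (hε k))
    (integrable_finsetSum _ fun y _ => integrable_finsetSum _ fun x _ => integrable_finsetSum _
      fun x' _ => (P.current_mul_log_rate_integrable hβ y x x').1.abs)
    (fun k => P.ae_regDissipationRate_mem_Icc hτ (hε k).le) ?_ ?_
  · filter_upwards [P.ae_current_mul_force_eq hτ, P.ae_tendsto_current_mul_log_add hτ hε₀]
      with t heq hlim
    simp only [dissipationRate, heq]
    exact tendsto_finsetSum _ fun y _ => tendsto_finsetSum _ fun x _ => tendsto_finsetSum _
      fun x' _ => (hlim y x x').const_add _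
  · have hneg : ∀ a : ℝ, Tendsto (fun k : ℕ => Real.negMulLog (a + 1 / ((k : ℝ) + 1))) atTop
        (𝓝 (Real.negMulLog a)) := fun a =>
      (Real.continuous_negMulLog.tendsto a).comp (by simpa using hε₀.const_add a)
    simp only [P.integral_regDissipationRate hβ hτ (hε _), entropyProduction_eq_sum]
    exact ((tendsto_finsetSum _ fun y _ => tendsto_finsetSum _ fun x _ =>
      (hneg _).sub (hneg _)).sub_const _).const_mul _

theorem entropyProduction_nonneg (hβ : β ≠ 0) (hτ : 0 ≤ τ) : 0 ≤ P.entropyProduction := by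
  linarith [(P.integrable_and_integral_dissipationRate hβ hτ).2,
    integral_nonneg_of_ae (P.ae_dissipationRate_nonneg hτ)]

end Dissipation

end FeedbackProcess

section LogMean

/-- The logarithmic mean `(a - b) / (log a - log b)`, extended by `a` to `a = b`; this is the
mobility of a transition with fluxes `a` and `b`. -/
noncomputable def logMean (a b : ℝ) : ℝ :=
  if a - b = 0 then a else (a - b) / Real.log (a / b)

theorem logMean_comm (a b : ℝ) : logMean a b = logMean b a := by
  unfold logMean
  by_cases h : a - b = 0
  · rw [if_pos h, if_pos (by linarith), sub_eq_zero.1 h]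
  · rw [if_neg h, if_neg fun h' => h (by linarith), ← neg_sub a b, ← inv_div a b, Real.log_inv,
      neg_div_neg_eq]

theorem measurable_logMean : Measurable fun z : ℝ × ℝ => logMean z.1 z.2 :=
  Measurable.ite (measurableSet_eq_fun (by fun_prop) measurable_const) (by fun_prop) (by fun_prop)

variable {a b : ℝ}

theorem sub_sq_eq_logMean_mul (ha : 0 < a) (hb : 0 < b) :
    (a - b) ^ 2 = logMean a b * ((a - b) * Real.log (a / b)) := by
  unfold logMean
  split_ifs with h
  · simp [h]
  · have hlog : Real.log (a / b) ≠ 0 := by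
      refine Real.log_ne_zero_of_pos_of_ne_one (div_pos ha hb) fun h1 => h ?_
      rw [(div_eq_one_iff_eq hb.ne').1 h1, sub_self]
    field_simp

theorem logMean_nonneg (ha : 0 < a) (hb : 0 < b) : 0 ≤ logMean a b := by
  unfold logMean
  split_ifs with h
  · exact ha.le
  · rw [Real.log_div ha.ne' hb.ne']
    rcases le_total b a with h' | h'
    · exact div_nonneg (sub_nonneg.2 h') (sub_nonneg.2 (Real.log_le_log hb h'))
    · exact div_nonneg_of_nonpos (sub_nonpos.2 h') (sub_nonpos.2 (Real.log_le_log ha h'))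

theorem logMean_le_max (ha : 0 < a) (hb : 0 < b) : logMean a b ≤ max a b := by
  wlog h : b ≤ a generalizing a b
  · rw [logMean_comm, max_comm]
    exact this hb ha (le_of_not_ge h)
  rw [max_eq_left h]
  unfold logMean
  split_ifs with h₀
  · exact le_rfl
  · have hlt : 1 < a / b := (one_lt_div hb).2 (h.lt_of_ne' (sub_ne_zero.1 h₀))
    have hlog := Real.one_sub_inv_le_log_of_pos (div_pos ha hb)
    rw [div_le_iff₀ (Real.log_pos hlt)]
    calc a - b = a * (1 - (a / b)⁻¹) := by field_simp
      _ ≤ a * Real.log (a / b) := mul_le_mul_of_nonneg_left hlog ha.le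

end LogMean

section PairSums

variable {ι : Type*} [Fintype ι]

theorem sum_sum_Iio_of_symm [LinearOrder ι] [LocallyFiniteOrderBot ι] {f : ι → ι → ℝ}
    (hf : ∀ x x', f x' x = f x x') (hf₀ : ∀ x, f x x = 0) :
    2 * ∑ x, ∑ x' ∈ Finset.Iio x, f x x' = ∑ x, ∑ x', f x x' := by
  have hIio : ∀ x, ∑ x' ∈ Finset.Iio x, f x x' = ∑ x', if x' < x then f x x' else 0 := fun x => by
    rw [← Finset.sum_filter]
    congr 1
    ext x'
    simp
  have hswap : ∑ x, ∑ x', (if x' < x then f x x' else 0) =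
      ∑ x, ∑ x', if x < x' then f x x' else 0 := by
    rw [Finset.sum_comm]
    exact Finset.sum_congr rfl fun x _ => Finset.sum_congr rfl fun x' _ => by rw [hf x x']
  simp only [hIio]
  rw [two_mul]
  nth_rewrite 2 [hswap]
  simp only [← Finset.sum_add_distrib]
  refine Finset.sum_congr rfl fun x _ => Finset.sum_congr rfl fun x' _ => ?_
  rcases lt_trichotomy x x' with h | rfl | h
  · simp [h, h.not_gt]
  · simp [hf₀]
  · simp [h, h.not_gt]

variable {J : ι → ι → ℝ}

theorem sum_sum_abs_of_antisymm (hJ : ∀ x x', J x' x = -J x x') :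
    ∑ x, ∑ x', |J x x'| = 2 * ∑ x, ∑ x', max (J x x') 0 := by
  have hswap : ∑ x, ∑ x', max (-J x x') 0 = ∑ x, ∑ x', max (J x x') 0 := by
    rw [Finset.sum_comm]
    exact Finset.sum_congr rfl fun x _ => Finset.sum_congr rfl fun x' _ => by rw [hJ x x', neg_neg]
  simp only [← max_zero_add_max_neg_zero_eq_abs_self, Finset.sum_add_distrib, hswap, two_mul]

theorem sum_le_sum_sum_max (J : ι → ι → ℝ) (y : ι) :
    ∑ x, J x y ≤ ∑ x, ∑ x', max (J x x') 0 :=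
  Finset.sum_le_sum fun x _ => (le_max_left _ _).trans <|
    Finset.single_le_sum (f := fun x' => max (J x x') 0) (fun _ _ => le_max_right _ _)
      (Finset.mem_univ y)

end PairSums

section Rates

variable {n : ℕ} (R : ℝ → Fin n → Fin n → Fin n → ℝ) (p : ℝ → Fin n → Fin n → ℝ)

/-- The probability carried per unit time by the currents, each transition counted in the direction
of its current. -/
noncomputable def transportRate (t : ℝ) : ℝ := ∑ y, ∑ x, ∑ x', max (current R p t y x x') 0

/-- The instantaneous mobility, whose time average is the mean mobility of a process. -/
noncomputable def mobility (t : ℝ) : ℝ :=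
  ∑ y, ∑ x, ∑ x' ∈ Finset.Iio x, localMobility R p t y x x'

theorem sum_abs_current (t : ℝ) :
    ∑ y, ∑ x, ∑ x', |current R p t y x x'| = 2 * transportRate R p t := by
  rw [transportRate, Finset.mul_sum]
  exact Finset.sum_congr rfl fun y _ => sum_sum_abs_of_antisymm (current_swap R p t y)

end Rates

namespace FeedbackProcess

variable {n : ℕ} {G : Fin n → SimpleGraph (Fin n)} {pY : Fin n → ℝ} {β τ : ℝ}
  (P : FeedbackProcess G pY β τ)

section Mobility

theorem two_mul_mobility (t : ℝ) : 2 * mobility P.rate P.prob t =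
    ∑ y, ∑ x, ∑ x', localMobility P.rate P.prob t y x x' := by
  rw [mobility, Finset.mul_sum]
  exact Finset.sum_congr rfl fun y _ => sum_sum_Iio_of_symm (fun x x' => logMean_comm _ _)
    fun x => by simp [localMobility, current, P.flux_self]

theorem ae_localMobility_mem_Icc (hτ : 0 ≤ τ) :
    ∀ᵐ t ∂(volume.restrict (Ioc 0 τ)), ∀ y x x', localMobility P.rate P.prob t y x x' ∈
      Icc 0 (max (flux P.rate P.prob t y x x') (flux P.rate P.prob t y x' x)) := by
  filter_upwards [P.ae_flux_pos_or_eq_zero hτ] with t ht y x x'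
  rcases ht y x x' with ⟨hj, hj'⟩ | ⟨hj, hj'⟩
  · exact ⟨logMean_nonneg hj hj', logMean_le_max hj hj'⟩
  · simp [localMobility, current, hj, hj']

theorem ae_sq_current_eq (hτ : 0 ≤ τ) : ∀ᵐ t ∂(volume.restrict (Ioc 0 τ)), ∀ y x x',
    current P.rate P.prob t y x x' ^ 2 = localMobility P.rate P.prob t y x x' *
      (current P.rate P.prob t y x x' * force P.rate P.prob t y x x') := by
  filter_upwards [P.ae_flux_pos_or_eq_zero hτ] with t ht y x x'
  rcases ht y x x' with ⟨hj, hj'⟩ | ⟨hj, hj'⟩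
  · exact sub_sq_eq_logMean_mul hj hj'
  · simp [current, hj, hj']

theorem localMobility_integrable (hτ : 0 ≤ τ) (y x x' : Fin n) :
    IntegrableOn (fun t => localMobility P.rate P.prob t y x x') (Ioc 0 τ) := by
  have hj := (P.flux_integrable y x x').1
  have hj' := (P.flux_integrable y x' x).1
  refine (hj.sup hj').mono' (measurable_logMean.comp_aemeasurable
    (hj.aemeasurable.prodMk hj'.aemeasurable)).aestronglyMeasurable ?_
  filter_upwards [P.ae_localMobility_mem_Icc hτ] with t ht
  rw [Real.norm_of_nonneg (ht y x x').1]
  exact (ht y x x').2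

theorem mobility_integrable (hτ : 0 ≤ τ) : IntegrableOn (mobility P.rate P.prob) (Ioc 0 τ) :=
  integrable_finsetSum _ fun y _ => integrable_finsetSum _ fun x _ => integrable_finsetSum _
    fun x' _ => P.localMobility_integrable hτ y x x'

theorem ae_mobility_nonneg (hτ : 0 ≤ τ) :
    0 ≤ᵐ[volume.restrict (Ioc 0 τ)] mobility P.rate P.prob := by
  filter_upwards [P.ae_localMobility_mem_Icc hτ] with t ht
  exact Finset.sum_nonneg fun y _ => Finset.sum_nonneg fun x _ => Finset.sum_nonneg
    fun x' _ => (ht y x x').1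

theorem integral_mobility (hτ : 0 < τ) :
    ∫ t in Ioc 0 τ, mobility P.rate P.prob t = τ * P.meanMobility := by
  rw [meanMobility, ← mul_assoc, mul_one_div_cancel hτ.ne', one_mul,
    intervalIntegral.integral_of_le hτ.le]
  rfl

end Mobility

section SpeedLimit

theorem max_current_integrable (y x x' : Fin n) :
    IntegrableOn (fun t => max (current P.rate P.prob t y x x') 0) (Ioc 0 τ) :=
  (P.current_integrable y x x').1.pos_part

theorem transportRate_integrable : IntegrableOn (transportRate P.rate P.prob) (Ioc 0 τ) :=
  integrable_finsetSum _ fun y _ => integrable_finsetSum _ fun x _ => integrable_finsetSum _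
    fun x' _ => P.max_current_integrable y x x'

theorem one_sub_sum_diag_le_integral_transportRate (hpY : ∑ y, pY y = 1) (hτ : 0 ≤ τ) :
    1 - ∑ y, P.prob τ y y ≤ ∫ t in Ioc 0 τ, transportRate P.rate P.prob t := by
  have hloss : ∀ y, pY y - P.prob τ y y =
      ∫ t in Ioc 0 τ, ∑ x, current P.rate P.prob t y x y := fun y => by
    rw [P.prob_eq ⟨hτ, le_rfl⟩, P.prob_zero, if_pos rfl, intervalIntegral.integral_of_le hτ]
    simp only [current_swap P.rate P.prob _ y y, Finset.sum_neg_distrib, integral_neg]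
    ring
  have hint : ∀ y, IntegrableOn (fun t => ∑ x, current P.rate P.prob t y x y) (Ioc 0 τ) := fun y =>
    integrable_finsetSum _ fun x _ => (P.current_integrable y x y).1
  rw [← hpY, ← Finset.sum_sub_distrib]
  simp only [hloss]
  rw [← integral_finsetSum _ fun y _ => hint y]
  exact integral_mono (integrable_finsetSum _ fun y _ => hint y) P.transportRate_integrable
    fun t => Finset.sum_le_sum fun y _ => sum_le_sum_sum_max _ y

theorem ae_sq_transportRate_le (hτ : 0 ≤ τ) : ∀ᵐ t ∂(volume.restrict (Ioc 0 τ)),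
    transportRate P.rate P.prob t ^ 2 ≤
      mobility P.rate P.prob t * (dissipationRate P.rate P.prob t / 2) := by
  filter_upwards [P.ae_localMobility_mem_Icc hτ, P.ae_current_mul_force_nonneg hτ,
    P.ae_sq_current_eq hτ] with t hm hd hsq
  have hcs : (2 * transportRate P.rate P.prob t) ^ 2 ≤
      2 * mobility P.rate P.prob t * dissipationRate P.rate P.prob t := by
    rw [← sum_abs_current, P.two_mul_mobility, dissipationRate]
    simp only [← Fintype.sum_prod_type']
    refine Finset.sum_sq_le_sum_mul_sum_of_sq_le_mul _ (fun z _ => (hm _ _ _).1)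
      (fun z _ => hd _ _ _) fun z _ => ?_
    rw [sq_abs, hsq]
  linarith

theorem sq_integral_transportRate_le (hβ : β ≠ 0) (hτ : 0 < τ) :
    (∫ t in Ioc 0 τ, transportRate P.rate P.prob t) ^ 2 ≤
      τ * P.meanMobility * P.entropyProduction := by
  obtain ⟨hd, hdint⟩ := P.integrable_and_integral_dissipationRate hβ hτ.le
  have h := sq_integral_le_integral_mul_integral P.transportRate_integrable
    (P.mobility_integrable hτ.le) (hd.div_const 2) (P.ae_mobility_nonneg hτ.le)
    ((P.ae_dissipationRate_nonneg hτ.le).mono fun t ht => div_nonneg ht zero_le_two)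
    (P.ae_sq_transportRate_le hτ.le)
  rwa [P.integral_mobility hτ, integral_div, hdint, mul_div_cancel_left₀ _ two_ne_zero] at h

theorem mul_meanMobility_nonneg (hτ : 0 < τ) : 0 ≤ τ * P.meanMobility := by
  rw [← P.integral_mobility hτ]
  exact integral_nonneg_of_ae (P.ae_mobility_nonneg hτ.le)

theorem sq_div_le_entropyProduction (hpY : ∑ y, pY y = 1) (hβ : β ≠ 0) (hτ : 0 < τ) {E : ℝ}
    (hE₀ : 0 ≤ E) (hE : E ≤ 1 - ∑ y, P.prob τ y y) :
    E ^ 2 / (τ * P.meanMobility) ≤ P.entropyProduction := by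
  refine div_le_of_le_mul₀ (P.mul_meanMobility_nonneg hτ) (P.entropyProduction_nonneg hβ hτ.le) ?_
  rw [mul_comm]
  exact (pow_le_pow_left₀ hE₀
    (hE.trans (P.one_sub_sum_diag_le_integral_transportRate hpY hτ.le)) 2).trans
    (P.sq_integral_transportRate_le hβ hτ)

end SpeedLimit

section UniformForce

variable {P} {F : ℝ}

theorem HasConstantUniformForce.ae_current (hF : P.HasConstantUniformForce F) (hτ : 0 ≤ τ) :
    ∀ᵐ t ∂(volume.restrict (Ioc 0 τ)), ∀ y x x',
      current P.rate P.prob t y x x' * force P.rate P.prob t y x x' =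
        F * |current P.rate P.prob t y x x'| ∧
      |current P.rate P.prob t y x x'| = F * localMobility P.rate P.prob t y x x' := by
  rw [HasConstantUniformForce, Measure.restrict_congr_set Ioc_ae_eq_Icc.symm] at hF
  filter_upwards [hF, P.ae_flux_pos_or_eq_zero hτ, P.ae_current_mul_force_nonneg hτ,
    P.ae_sq_current_eq hτ] with t hforce hflux hd hsq y x x'
  rcases hflux y x x' with ⟨hj, hj'⟩ | ⟨hj, hj'⟩
  · have habs := hforce y x x' hj.ne'
    have hdiss : current P.rate P.prob t y x x' * force P.rate P.prob t y x x' =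
        F * |current P.rate P.prob t y x x'| := by
      rw [← abs_of_nonneg (hd y x x'), abs_mul, habs, mul_comm]
    refine ⟨hdiss, ?_⟩
    by_cases hJ : current P.rate P.prob t y x x' = 0
    · have hF₀ : F = 0 := by
        rw [← habs, force, sub_eq_zero.1 hJ, div_self hj'.ne', Real.log_one, abs_zero]
      rw [hJ, hF₀, abs_zero, zero_mul]
    · have hsq' := hsq y x x'
      rw [hdiss, ← sq_abs] at hsq'
      refine mul_right_cancel₀ (abs_ne_zero.2 hJ) ?_
      linarith
  · simp [current, localMobility, hj, hj']

theorem HasConstantUniformForce.integral_transportRate (hF : P.HasConstantUniformForce F)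
    (hτ : 0 < τ) :
    ∫ t in Ioc 0 τ, transportRate P.rate P.prob t = F * (τ * P.meanMobility) := by
  rw [← P.integral_mobility hτ, ← integral_const_mul]
  refine integral_congr_ae ?_
  filter_upwards [hF.ae_current hτ.le] with t ht
  have h := sum_abs_current P.rate P.prob t
  simp only [fun y x x' => (ht y x x').2, ← Finset.mul_sum, ← P.two_mul_mobility] at h
  linarith

theorem HasConstantUniformForce.entropyProduction_eq_mul (hF : P.HasConstantUniformForce F)
    (hβ : β ≠ 0) (hτ : 0 ≤ τ) :
    P.entropyProduction = F * ∫ t in Ioc 0 τ, transportRate P.rate P.prob t := by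
  refine mul_left_cancel₀ two_ne_zero ?_
  rw [← (P.integrable_and_integral_dissipationRate hβ hτ).2, mul_left_comm,
    ← integral_const_mul, ← integral_const_mul]
  refine integral_congr_ae ?_
  filter_upwards [hF.ae_current hτ] with t ht
  simp only [dissipationRate, fun y x x' => (ht y x x').1, ← Finset.mul_sum, sum_abs_current]

theorem HasConstantUniformForce.entropyProduction_eq (hF : P.HasConstantUniformForce F)
    (hβ : β ≠ 0) (hτ : 0 < τ) : P.entropyProduction =
      (∫ t in Ioc 0 τ, transportRate P.rate P.prob t) ^ 2 / (τ * P.meanMobility) := by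
  rw [hF.entropyProduction_eq_mul hβ hτ.le, hF.integral_transportRate hτ]
  rcases eq_or_ne (τ * P.meanMobility) 0 with hM | _
  · simp [hM]
  · field_simp

end UniformForce

end FeedbackProcess

section Transport

variable {n : ℕ} {G : Fin n → SimpleGraph (Fin n)} {pY : Fin n → ℝ} {β τ : ℝ}

theorem IsTransportPlan.eq_of_diag {p q : Fin n → Fin n → ℝ} {π : Fin n → Fin n → Fin n → ℝ}
    (hπ : IsTransportPlan p q π) (hp : ∀ x y, x ≠ y → p x y = 0) (y x x' : Fin n) :
    π y x x' = if x' = y then q x y else 0 := by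
  have hzero : ∀ x', x' ≠ y → π y x x' = 0 := fun x' hne =>
    (Finset.sum_eq_zero_iff_of_nonneg fun x _ => hπ.nonneg y x x').1
      ((hπ.source y x').trans (hp x' y hne)) x (Finset.mem_univ x)
  split_ifs with h
  · rw [h, ← hπ.target y x, Finset.sum_eq_single y (fun x' _ hne => hzero x' hne) (by simp)]
  · exact hzero x' h

namespace FeedbackProcess.TransportsAlong

variable {P : FeedbackProcess G pY β τ} {π : Fin n → Fin n → Fin n → ℝ}

theorem integral_max_current (htr : P.TransportsAlong π) (hτ : 0 ≤ τ)
    (hπ : IsTransportPlan (P.prob 0) (P.prob τ) π) (y x x' : Fin n) :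
    ∫ t in Ioc 0 τ, max (current P.rate P.prob t y x x') 0 =
      if x' = y then (if x = y then 0 else P.prob τ x y) else 0 := by
  by_cases hne : x = x'
  · subst hne
    have h : x = y → x ≠ y → 0 = P.prob τ x y := fun h hne => absurd h hne
    simpa [current] using h
  · rw [← intervalIntegral.integral_of_le hτ, htr y x x' hne,
      hπ.eq_of_diag fun x y hxy => by rw [P.prob_zero, if_neg hxy]]
    by_cases hx' : x' = y
    · rw [if_pos hx', if_pos hx', if_neg fun hx => hne (hx.trans hx'.symm)]
    · rw [if_neg hx', if_neg hx']

theorem integral_transportRate (htr : P.TransportsAlong π) (hpY : ∑ y, pY y = 1) (hτ : 0 ≤ τ)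
    (hπ : IsTransportPlan (P.prob 0) (P.prob τ) π) :
    ∫ t in Ioc 0 τ, transportRate P.rate P.prob t = 1 - ∑ y, P.prob τ y y := by
  have hint := P.max_current_integrable
  have hsum : ∀ y, ∑ x, (if x = y then 0 else P.prob τ x y) = pY y - P.prob τ y y := fun y => by
    have hdiff : ∀ x, (if x = y then 0 else P.prob τ x y) =
        P.prob τ x y - if x = y then P.prob τ x y else 0 := fun x => by
      split_ifs <;> ring
    simp [hdiff, Finset.sum_sub_distrib, P.sum_prob ⟨hτ, le_rfl⟩]
  simp only [transportRate]
  rw [integral_finsetSum _ fun y _ => integrable_finsetSum _ fun x _ => integrable_finsetSum _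
    fun x' _ => hint y x x', ← hpY, ← Finset.sum_sub_distrib]
  refine Finset.sum_congr rfl fun y _ => ?_
  rw [integral_finsetSum _ fun x _ => integrable_finsetSum _ fun x' _ => hint y x x', ← hsum y]
  refine Finset.sum_congr rfl fun x _ => ?_
  rw [integral_finsetSum _ fun x' _ => hint y x x']
  simp [htr.integral_max_current hτ hπ]

end FeedbackProcess.TransportsAlong

end Transport

section ForcedFlux

/-- The flux of a transition with net current `c` and thermodynamic force `±F`: fluxes `j` and `j'`
with `j - j' = c` and `j = j' * exp (±F)`, where the sign is that of `c`. -/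
noncomputable def forcedFlux (F c : ℝ) : ℝ :=
  (max c 0 * Real.exp F + max (-c) 0) / (Real.exp F - 1)

variable {F c : ℝ}

theorem forcedFlux_zero (F : ℝ) : forcedFlux F 0 = 0 := by simp [forcedFlux]

theorem forcedFlux_of_pos (F : ℝ) (hc : 0 < c) :
    forcedFlux F c = c / (Real.exp F - 1) * Real.exp F := by
  rw [forcedFlux, max_eq_left hc.le, max_eq_right (neg_nonpos.2 hc.le), add_zero,
    mul_div_right_comm]

theorem forcedFlux_of_neg (F : ℝ) (hc : c < 0) : forcedFlux F c = -c / (Real.exp F - 1) := by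
  rw [forcedFlux, max_eq_right hc.le, max_eq_left (neg_nonneg.2 hc.le), zero_mul, zero_add]

theorem forcedFlux_pos (hF : 0 < F) (hc : c ≠ 0) : 0 < forcedFlux F c := by
  have hF' := sub_pos.2 (Real.one_lt_exp_iff.2 hF)
  rcases hc.lt_or_gt with hc | hc
  · rw [forcedFlux_of_neg F hc]
    exact div_pos (neg_pos.2 hc) hF'
  · rw [forcedFlux_of_pos F hc]
    positivity

theorem forcedFlux_nonneg (hF : 0 < F) (c : ℝ) : 0 ≤ forcedFlux F c := by
  rcases eq_or_ne c 0 with rfl | hc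
  · rw [forcedFlux_zero]
  · exact (forcedFlux_pos hF hc).le

theorem forcedFlux_sub_forcedFlux_neg (hF : 0 < F) (c : ℝ) :
    forcedFlux F c - forcedFlux F (-c) = c := by
  have hF' := (sub_pos.2 (Real.one_lt_exp_iff.2 hF)).ne'
  have hc : max c 0 - max (-c) 0 = c := max_zero_sub_max_neg_zero_eq_self c
  rw [forcedFlux, forcedFlux, neg_neg, ← sub_div, div_eq_iff hF']
  linear_combination (Real.exp F - 1) * hc

theorem abs_log_forcedFlux_div (hF : 0 < F) (hc : c ≠ 0) :
    |Real.log (forcedFlux F c / forcedFlux F (-c))| = F := by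
  wlog hpos : 0 < c generalizing c
  · have hneg := this (neg_ne_zero.2 hc) (neg_pos.2 (hc.lt_of_le (not_lt.1 hpos)))
    rwa [neg_neg, ← inv_div, Real.log_inv, abs_neg] at hneg
  have hback : c / (Real.exp F - 1) ≠ 0 :=
    div_ne_zero hc (sub_pos.2 (Real.one_lt_exp_iff.2 hF)).ne'
  rw [forcedFlux_of_pos F hpos, forcedFlux_of_neg F (neg_neg_iff_pos.2 hpos), neg_neg,
    mul_div_cancel_left₀ _ hback, Real.log_exp, abs_of_pos hF]

end ForcedFlux

section Star

variable {n : ℕ} (pY : Fin n → ℝ) (q : Fin n → Fin n → ℝ) (τ F : ℝ)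

/-- Linear interpolation, over `[0, τ]`, between the distribution after an error-free measurement
and `q`. -/
noncomputable def starProb (t : ℝ) (x y : Fin n) : ℝ :=
  (1 - t / τ) * (if x = y then pY y else 0) + t / τ * q x y

/-- The constant currents that carry the probability `q x y` from `(y, y)` to `(x, y)` within
time `τ`, along the edges of a star centred at `y`. -/
noncomputable def starCurrent (y x x' : Fin n) : ℝ :=
  ((if x' = y then q x y else 0) - if x = y then q x' y else 0) / τ

/-- The rates that generate the currents `starCurrent` with a force of magnitude `F` during
`(0, τ)`. They are switched off outside, where `starProb` may vanish. -/
noncomputable def starRate (t : ℝ) (y x x' : Fin n) : ℝ :=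
  if t ∈ Ioo 0 τ then forcedFlux F (starCurrent q τ y x x') / starProb pY q τ t x' y else 0

variable {pY q τ F}

theorem starCurrent_swap (y x x' : Fin n) : starCurrent q τ y x' x = -starCurrent q τ y x x' := by
  rw [starCurrent, starCurrent, ← neg_div, neg_sub]

theorem sum_starCurrent (hY : ∀ y, ∑ x, q x y = pY y) (x y : Fin n) :
    ∑ x', starCurrent q τ y x x' = (q x y - if x = y then pY y else 0) / τ := by
  simp only [starCurrent, ← Finset.sum_div, Finset.sum_sub_distrib]
  by_cases h : x = y <;> simp [h, hY]

theorem max_starCurrent (hq : ∀ x y, 0 ≤ q x y) (hτ : 0 ≤ τ) {x x' : Fin n} (h : x ≠ x')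
    (y : Fin n) : max (starCurrent q τ y x x') 0 = (if x' = y then q x y else 0) / τ := by
  unfold starCurrent
  by_cases hx' : x' = y
  · have hx : x ≠ y := fun hx => h (hx.trans hx'.symm)
    simp [hx', hx, div_nonneg (hq x y) hτ]
  · rw [if_neg hx', zero_sub, zero_div, neg_div]
    refine max_eq_right (neg_nonpos.2 (div_nonneg ?_ hτ))
    split_ifs
    exacts [hq x' y, le_rfl]

theorem of_starCurrent_ne_zero {y x x' : Fin n} (h : starCurrent q τ y x x' ≠ 0) :
    (x' = y ∧ x ≠ y ∧ q x y ≠ 0) ∨ (x = y ∧ x' ≠ y ∧ q x' y ≠ 0) := by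
  unfold starCurrent at h
  by_cases hx : x = y <;> by_cases hx' : x' = y <;> simp_all

theorem starProb_nonneg (hp : ∀ y, 0 ≤ pY y) (hq : ∀ x y, 0 ≤ q x y) {t : ℝ}
    (ht : t ∈ Icc 0 τ) (x y : Fin n) : 0 ≤ starProb pY q τ t x y := by
  have hτ := ht.1.trans ht.2
  refine add_nonneg (mul_nonneg (sub_nonneg.2 (div_le_one_of_le₀ ht.2 hτ)) ?_)
    (mul_nonneg (div_nonneg ht.1 hτ) (hq x y))
  split_ifs
  exacts [hp y, le_rfl]

theorem starProb_pos (hq : ∀ x y, 0 ≤ q x y) (hY : ∀ y, ∑ x, q x y = pY y) {t : ℝ}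
    (ht : t ∈ Ioo 0 τ) {y x x' : Fin n} (h : starCurrent q τ y x x' ≠ 0) :
    0 < starProb pY q τ t x' y := by
  have hτ := ht.1.trans ht.2
  have ht₀ : 0 < t / τ := div_pos ht.1 hτ
  have ht₁ : 0 < 1 - t / τ := sub_pos.2 ((div_lt_one hτ).2 ht.2)
  rcases of_starCurrent_ne_zero h with ⟨rfl, -, hqx⟩ | ⟨-, hx', hqx'⟩
  · have hp : 0 < pY x' := by
      rw [← hY x']
      exact Finset.sum_pos' (fun x _ => hq x x') ⟨x, Finset.mem_univ x, (hq x x').lt_of_ne' hqx⟩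
    rw [starProb, if_pos rfl]
    exact add_pos_of_pos_of_nonneg (mul_pos ht₁ hp) (mul_nonneg ht₀.le (hq x' x'))
  · rw [starProb, if_neg hx', mul_zero, zero_add]
    exact mul_pos ht₀ ((hq x' y).lt_of_ne' hqx')

theorem starProb_eq_add_mul (t : ℝ) (x y : Fin n) : starProb pY q τ t x y =
    (if x = y then pY y else 0) + (q x y - if x = y then pY y else 0) / τ * t := by
  rw [starProb]
  ring

theorem flux_star (hq : ∀ x y, 0 ≤ q x y) (hY : ∀ y, ∑ x, q x y = pY y) {t : ℝ}
    (ht : t ∈ Ioo 0 τ) (y x x' : Fin n) :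
    flux (starRate pY q τ F) (starProb pY q τ) t y x x' =
      forcedFlux F (starCurrent q τ y x x') := by
  rw [flux, starRate, if_pos ht]
  rcases eq_or_ne (starCurrent q τ y x x') 0 with h | h
  · rw [h, forcedFlux_zero, zero_div, zero_mul]
  · exact div_mul_cancel₀ _ (starProb_pos hq hY ht h).ne'

theorem current_star (hq : ∀ x y, 0 ≤ q x y) (hY : ∀ y, ∑ x, q x y = pY y) (hF : 0 < F) {t : ℝ}
    (ht : t ∈ Ioo 0 τ) (y x x' : Fin n) :
    current (starRate pY q τ F) (starProb pY q τ) t y x x' = starCurrent q τ y x x' := by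
  rw [current, flux_star hq hY ht, flux_star hq hY ht, starCurrent_swap y x x',
    forcedFlux_sub_forcedFlux_neg hF]

theorem starRate_nonneg (hp : ∀ y, 0 ≤ pY y) (hq : ∀ x y, 0 ≤ q x y) (hF : 0 < F) (t : ℝ)
    (y x x' : Fin n) : 0 ≤ starRate pY q τ F t y x x' := by
  unfold starRate
  split_ifs with ht
  · exact div_nonneg (forcedFlux_nonneg hF _) (starProb_nonneg hp hq (Ioo_subset_Icc_self ht) x' y)
  · exact le_rfl

theorem starRate_ne_zero_iff (hq : ∀ x y, 0 ≤ q x y) (hY : ∀ y, ∑ x, q x y = pY y) (hF : 0 < F)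
    (t : ℝ) (y x x' : Fin n) :
    starRate pY q τ F t y x x' ≠ 0 ↔ t ∈ Ioo 0 τ ∧ starCurrent q τ y x x' ≠ 0 := by
  refine ⟨fun h => ?_, fun ⟨ht, h⟩ => ?_⟩
  · unfold starRate at h
    split_ifs at h with ht
    · exact ⟨ht, fun h₀ => h (by rw [h₀, forcedFlux_zero, zero_div])⟩
    · exact absurd rfl h
  · rw [starRate, if_pos ht]
    exact (div_pos (forcedFlux_pos hF h) (starProb_pos hq hY ht h)).ne'

theorem integral_sum_star (hq : ∀ x y, 0 ≤ q x y) (hY : ∀ y, ∑ x, q x y = pY y) (hF : 0 < F)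
    {t : ℝ} (ht : t ∈ Icc 0 τ) (x y : Fin n) :
    ∫ s in (0 : ℝ)..t, ∑ x', current (starRate pY q τ F) (starProb pY q τ) s y x x' =
      (q x y - if x = y then pY y else 0) / τ * t := by
  have hconst : EqOn (fun s => ∑ x', current (starRate pY q τ F) (starProb pY q τ) s y x x')
      (fun _ => (q x y - if x = y then pY y else 0) / τ) (uIoo 0 t) := fun s hs => by
    rw [uIoo_of_le ht.1] at hs
    simp only [current_star hq hY hF ⟨hs.1, hs.2.trans_le ht.2⟩, sum_starCurrent hY]
  rw [intervalIntegral.integral_congr_uIoo hconst, intervalIntegral.integral_const, sub_zero,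
    smul_eq_mul, mul_comm]

theorem intervalIntegrable_log_add_mul (a b c d : ℝ) :
    IntervalIntegrable (fun t => Real.log (a + b * t)) volume c d := by
  have h : MeromorphicOn (fun t : ℝ => a + b * t) (uIcc c d) := fun t _ => by fun_prop
  simpa only [Real.norm_eq_abs, Real.log_abs] using h.intervalIntegrable_log_norm

theorem log_starProb_integrable (x y : Fin n) :
    IntervalIntegrable (fun t => Real.log (starProb pY q τ t x y)) volume 0 τ := by
  simp only [starProb_eq_add_mul]
  exact intervalIntegrable_log_add_mul _ _ _ _

theorem heat_mul_flux_star_integrable (β : ℝ) (hq : ∀ x y, 0 ≤ q x y)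
    (hY : ∀ y, ∑ x, q x y = pY y) (hτ : 0 ≤ τ) (hF : 0 < F) (y x x' : Fin n) :
    IntervalIntegrable (fun t => heat (starRate pY q τ F) β t y x x' *
      flux (starRate pY q τ F) (starProb pY q τ) t y x x') volume 0 τ := by
  set c := starCurrent q τ y x x' with hc
  rcases eq_or_ne c 0 with h | h
  · refine (intervalIntegrable_const (c := (0 : ℝ))).congr_uIoo fun t ht => ?_
    rw [uIoo_of_le hτ] at ht
    simp only [flux_star hq hY ht, ← hc, h, forcedFlux_zero, mul_zero]
  · have hlog : IntervalIntegrable (fun t => -(1 / β) *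
        ((Real.log (forcedFlux F c) - Real.log (forcedFlux F (-c))) +
          (Real.log (starProb pY q τ t x y) - Real.log (starProb pY q τ t x' y))) *
        forcedFlux F c) volume 0 τ :=
      ((intervalIntegrable_const.add ((log_starProb_integrable x y).sub
        (log_starProb_integrable x' y))).const_mul _).mul_const _
    refine hlog.congr_uIoo fun t ht => ?_
    rw [uIoo_of_le hτ] at ht
    have hneg : starCurrent q τ y x' x = -c := starCurrent_swap y x x'
    have hpos := (starProb_pos hq hY ht h).ne'
    have hpos' := (starProb_pos hq hY ht (hneg.trans_ne (neg_ne_zero.2 h))).ne'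
    have hj := (forcedFlux_pos hF h).ne'
    have hj' := (forcedFlux_pos hF (neg_ne_zero.2 h)).ne'
    simp only [flux_star hq hY ht, heat, starRate, if_pos ht, hneg, ← hc]
    rw [Real.log_div (div_ne_zero hj hpos) (div_ne_zero hj' hpos'), Real.log_div hj hpos,
      Real.log_div hj' hpos']
    ring

/-- The process in which the probability flows from `(y, y)` directly to every `(x, y)`, with
constant currents and thermodynamic forces of magnitude `F`, until the distribution `q` is
reached. -/
noncomputable def starProcess {G : Fin n → SimpleGraph (Fin n)} (β : ℝ) (hG : ConditionC G)
    (hp : ∀ y, 0 ≤ pY y) (hq : ∀ x y, 0 ≤ q x y) (hY : ∀ y, ∑ x, q x y = pY y) (hτ : 0 < τ)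
    (hF : 0 < F) : FeedbackProcess G pY β τ where
  rate := starRate pY q τ F
  prob := starProb pY q τ
  rate_measurable y x x' := by
    unfold starRate starProb
    exact Measurable.ite measurableSet_Ioo (by fun_prop) measurable_const
  rate_nonneg := starRate_nonneg hp hq hF
  rate_eq_zero t y x x' := by
    contrapose!
    rw [starRate_ne_zero_iff hq hY hF]
    rintro ⟨-, h⟩
    rcases of_starCurrent_ne_zero h with ⟨rfl, hx, -⟩ | ⟨rfl, hx', -⟩
    exacts [hG x' x hx, (hG x x' hx').symm]
  rate_bidirectional t y x x' := by
    contrapose!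
    rw [starRate_ne_zero_iff hq hY hF, starRate_ne_zero_iff hq hY hF, starCurrent_swap, neg_ne_zero]
    exact id
  prob_nonneg t := starProb_nonneg hp hq
  prob_zero x y := by simp [starProb]
  flux_integrable y x x' := intervalIntegrable_const.congr_uIoo fun t ht =>
    (flux_star hq hY (by rwa [uIoo_of_le hτ.le] at ht) y x x').symm
  master t ht x y := by
    rw [starProb_eq_add_mul, starProb_eq_add_mul, mul_zero, add_zero, add_right_inj]
    exact (integral_sum_star hq hY hF ht x y).symm
  heat_integrable := heat_mul_flux_star_integrable β hq hY hτ.le hF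

variable {G : Fin n → SimpleGraph (Fin n)} {β : ℝ}

theorem starProb_end (hτ : τ ≠ 0) : starProb pY q τ τ = q := by
  funext x y
  simp [starProb, div_self hτ]

theorem starProcess_hasConstantUniformForce (hG : ConditionC G) (hp : ∀ y, 0 ≤ pY y)
    (hq : ∀ x y, 0 ≤ q x y) (hY : ∀ y, ∑ x, q x y = pY y) (hτ : 0 < τ) (hF : 0 < F) :
    (starProcess β hG hp hq hY hτ hF).HasConstantUniformForce F := by
  rw [FeedbackProcess.HasConstantUniformForce, Measure.restrict_congr_set Ioo_ae_eq_Icc.symm,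
    ae_restrict_iff' measurableSet_Ioo]
  refine ae_of_all _ fun t ht y x x' h => ?_
  simp only [starProcess, force, flux_star hq hY ht, starCurrent_swap y x x'] at h ⊢
  exact abs_log_forcedFlux_div hF fun hc => h (by rw [hc, forcedFlux_zero])

theorem starProcess_transportsAlong (hG : ConditionC G) (hp : ∀ y, 0 ≤ pY y)
    (hq : ∀ x y, 0 ≤ q x y) (hY : ∀ y, ∑ x, q x y = pY y) (hτ : 0 < τ) (hF : 0 < F) :
    (starProcess β hG hp hq hY hτ hF).TransportsAlong
      fun y x x' => if x' = y then q x y else 0 := by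
  intro y x x' hne
  have hconst : EqOn
      (fun t => max (current (starRate pY q τ F) (starProb pY q τ) t y x x') 0)
      (fun _ => (if x' = y then q x y else 0) / τ) (uIoo 0 τ) := fun t ht => by
    rw [uIoo_of_le hτ.le] at ht
    simp only [current_star hq hY hF ht, max_starCurrent hq hτ.le hne]
  refine (intervalIntegral.integral_congr_uIoo hconst).trans ?_
  rw [intervalIntegral.integral_const, smul_eq_mul, sub_zero, mul_div_cancel₀ _ hτ.ne']

theorem isOptimalPlan_star {p : Fin n → Fin n → ℝ} (hp : ∀ x y, p x y = if x = y then pY y else 0)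
    (hq : ∀ x y, 0 ≤ q x y) (hY : ∀ y, ∑ x, q x y = pY y) :
    IsOptimalPlan G p q fun y x x' => if x' = y then q x y else 0 := by
  refine ⟨⟨fun y x x' => ?_, fun y x' => ?_, fun y x => by simp⟩, fun π' hπ' => ?_⟩
  · split_ifs
    exacts [hq x y, le_rfl]
  · rw [hp]
    split_ifs
    exacts [hY y, Finset.sum_const_zero]
  · have h := hπ'.eq_of_diag fun x y hne => by rw [hp, if_neg hne]
    simp only [transportCost, h, le_refl]

theorem starProcess_isOptimalProtocolTo (hG : ConditionC G) (hp : ∀ y, 0 ≤ pY y)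
    (hq : ∀ x y, 0 ≤ q x y) (hY : ∀ y, ∑ x, q x y = pY y) (hτ : 0 < τ) (hF : 0 < F) :
    (starProcess β hG hp hq hY hτ hF).IsOptimalProtocolTo q := by
  have hend : (starProcess β hG hp hq hY hτ hF).prob τ = q := starProb_end hτ.ne'
  refine ⟨hend, ⟨_, ?_, starProcess_transportsAlong hG hp hq hY hτ hF⟩, F,
    starProcess_hasConstantUniformForce hG hp hq hY hτ hF⟩
  rw [hend]
  exact isOptimalPlan_star (FeedbackProcess.prob_zero _) hq hY

end Star

section Optimality

variable {n : ℕ} {G : Fin n → SimpleGraph (Fin n)} {pY : Fin n → ℝ} {q : Fin n → Fin n → ℝ}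
  {β τ : ℝ}

namespace FeedbackProcess

theorem abs_deltaI_mem_Icc (P : FeedbackProcess G pY β τ) (hpY : pY ∈ stdSimplex ℝ (Fin n))
    (hτ : 0 ≤ τ) : |P.deltaI| ∈ Icc 0 (entropy pY) := by
  have hτ' : τ ∈ Icc 0 τ := ⟨hτ, le_rfl⟩
  rw [P.abs_deltaI hτ]
  exact ⟨condEntropy_nonneg (P.prob_nonneg τ hτ'),
    condEntropy_le_entropy hpY (P.prob_nonneg τ hτ') (P.sum_prob hτ')⟩

theorem neg_abs_deltaI_add_le_entropyProductionX [NeZero n] (P : FeedbackProcess G pY β τ)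
    (hpY : pY ∈ stdSimplex ℝ (Fin n)) (hβ : β ≠ 0) (hτ : 0 < τ) :
    -|P.deltaI| + Wmin pY |P.deltaI| ^ 2 / (τ * P.meanMobility) ≤ P.entropyProductionX := by
  have hτ' : τ ∈ Icc 0 τ := ⟨hτ.le, le_rfl⟩
  rw [P.entropyProductionX_eq hτ.le, add_le_add_iff_left]
  refine P.sq_div_le_entropyProduction hpY.2 hβ hτ
    (Wmin_mem hpY (P.abs_deltaI_mem_Icc hpY hτ.le)).1 ?_
  rw [P.abs_deltaI hτ.le]
  exact Wmin_condEntropy_le hpY (P.prob_nonneg τ hτ') (P.sum_prob hτ')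

namespace IsOptimalProtocolTo

variable {P : FeedbackProcess G pY β τ}

theorem integral_transportRate (hP : P.IsOptimalProtocolTo q) (hpY : ∑ y, pY y = 1) (hτ : 0 ≤ τ) :
    ∫ t in Ioc 0 τ, transportRate P.rate P.prob t = 1 - ∑ y, q y y := by
  obtain ⟨rfl, ⟨π, hπ, htr⟩, -⟩ := hP
  exact htr.integral_transportRate hpY hτ hπ.1

theorem entropyProductionX_eq (hP : P.IsOptimalProtocolTo q) (hpY : ∑ y, pY y = 1) (hβ : β ≠ 0)
    (hτ : 0 < τ) : P.entropyProductionX =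
      -|P.deltaI| + (1 - ∑ y, q y y) ^ 2 / (τ * P.meanMobility) := by
  obtain ⟨F, hF⟩ := hP.2.2
  rw [P.entropyProductionX_eq hτ.le, hF.entropyProduction_eq hβ hτ,
    hP.integral_transportRate hpY hτ.le]

end IsOptimalProtocolTo

end FeedbackProcess

theorem exists_isOptimalProtocolTo_meanMobility_eq (hG : ConditionC G)
    (hpY : pY ∈ stdSimplex ℝ (Fin n)) (hq : ∀ x y, 0 ≤ q x y) (hY : ∀ y, ∑ x, q x y = pY y)
    (hE : 0 < 1 - ∑ y, q y y) (hτ : 0 < τ) {m : ℝ} (hm : 0 < m) :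
    ∃ P : FeedbackProcess G pY β τ, P.IsOptimalProtocolTo q ∧ P.meanMobility = m := by
  -- The transported probability is `F * τ * ⟨m⟩`, which dictates the force.
  have hF : 0 < (1 - ∑ y, q y y) / (τ * m) := div_pos hE (mul_pos hτ hm)
  have hP := starProcess_isOptimalProtocolTo (β := β) hG hpY.1 hq hY hτ hF
  have hmob := (starProcess_hasConstantUniformForce (β := β) hG hpY.1 hq hY hτ
    hF).integral_transportRate hτ
  refine ⟨_, hP, ?_⟩
  rw [hP.integral_transportRate hpY.2 hτ.le, div_mul_eq_mul_div, eq_div_iff (mul_pos hτ hm).ne',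
    mul_right_inj' hE.ne', mul_right_inj' hτ.ne'] at hmob
  exact hmob.symm

end Optimality

end Feedback

theorem mainTheorem2 (n : ℕ) [NeZero n] (pY : Fin n → ℝ) (hpY : pY ∈ stdSimplex ℝ (Fin n))
    (G : Fin n → SimpleGraph (Fin n)) (β τ : ℝ) (hβ : 0 < β) (hτ : 0 < τ) :
    -- `W ↦ S(p̃_W)` is strictly increasing on `[0, 1 - p↓(1)]`, constant beyond, and `Wmin` is
    -- its inverse `[0, S(pY)] → [0, 1 - p↓(1)]`
    (StrictMonoOn (Feedback.fanoEntropy pY) (Icc 0 (1 - Feedback.pDown pY 0)) ∧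
      (∀ W, 1 - Feedback.pDown pY 0 ≤ W → Feedback.fanoEntropy pY W = Feedback.entropy pY) ∧
      BijOn (Feedback.fanoEntropy pY) (Icc 0 (1 - Feedback.pDown pY 0))
        (Icc 0 (Feedback.entropy pY)) ∧
      InvOn (Feedback.Wmin pY) (Feedback.fanoEntropy pY) (Icc 0 (1 - Feedback.pDown pY 0))
        (Icc 0 (Feedback.entropy pY))) ∧
    -- the speed limit
    (∀ P : Feedback.FeedbackProcess G pY β τ,
      |P.deltaI| ∈ Icc 0 (Feedback.entropy pY) ∧
      P.entropyProductionX ≥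
        -|P.deltaI| + Feedback.Wmin pY |P.deltaI| ^ 2 / (τ * P.meanMobility)) ∧
    -- its attainment, for every way `σ` of ranking the states by descending probability
    (Feedback.ConditionC G →
      ∀ σ : Equiv.Perm (Fin n), Antitone (pY ∘ σ.symm) →
      ∀ I ∈ Ioc 0 (Feedback.entropy pY),
        (∀ P : Feedback.FeedbackProcess G pY β τ,
          P.IsOptimalProtocolTo (Feedback.optFinal pY σ (Feedback.Wmin pY I)) →
            |P.deltaI| = I ∧
            P.entropyProductionX =
              -|P.deltaI| + Feedback.Wmin pY |P.deltaI| ^ 2 / (τ * P.meanMobility)) ∧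
        ∀ m : ℝ, 0 < m → ∃ P : Feedback.FeedbackProcess G pY β τ,
          P.IsOptimalProtocolTo (Feedback.optFinal pY σ (Feedback.Wmin pY I)) ∧
          P.meanMobility = m) := by
  refine ⟨⟨Feedback.strictMonoOn_fanoEntropy hpY, fun W hW => Feedback.fanoEntropy_of_le hW,
    Feedback.bijOn_fanoEntropy hpY, Feedback.invOn_Wmin hpY⟩, fun P =>
    ⟨P.abs_deltaI_mem_Icc hpY hτ.le, P.neg_abs_deltaI_add_le_entropyProductionX hpY hβ.ne' hτ⟩,
    fun hG σ hσ I hI => ?_⟩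
  have hI' : I ∈ Icc 0 (Feedback.entropy pY) := Ioc_subset_Icc_self hI
  have hW := Feedback.Wmin_mem hpY hI'
  have herr : 1 - ∑ y, Feedback.optFinal pY σ (Feedback.Wmin pY I) y y = Feedback.Wmin pY I := by
    rw [Feedback.sum_optFinal_diag hpY hW hσ, sub_sub_cancel]
  refine ⟨fun P hP => ?_, fun m hm => ?_⟩
  · have hinfo : |P.deltaI| = I := by
      rw [P.abs_deltaI hτ.le, hP.1, Feedback.condEntropy_optFinal hpY hW hσ,
        (Feedback.invOn_Wmin hpY).2 hI']
    refine ⟨hinfo, ?_⟩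
    rw [hP.entropyProductionX_eq hpY.2 hβ.ne' hτ, herr, hinfo]
  · exact Feedback.exists_isOptimalProtocolTo_meanMobility_eq hG hpY
      (Feedback.optFinal_nonneg hpY hW hσ) (Feedback.sum_optFinal hpY hW hσ)
      (herr.symm ▸ Feedback.Wmin_pos hpY hI) hτ hm
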